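/- Let $I(v)=\min\bigl(\sqrt{\pi v},\,1,\,\sqrt{\pi(1-v)}\bigr)$ for $v\in[0,1]$ (the isoperimetric profile of the flat torus $\mathbf T^2=\mathbb R^2/(2\mathbb Z^2)$ with its uniform probability measure), let $R=\frac12+\frac1\pi$, and let $\varphi$ be the even probability density on $(-R,R)$ given by $\varphi(s)=1$ for $|s|\le\frac12-\frac1\pi$ and $\varphi(s)=\frac{\pi}{2}\left(\frac1\pi+\frac12-|s|\right)$ for $\frac12-\frac1\pi\le|s|<R$. Put $\Phi(s)=\int_{-R}^s\varphi(x)\,dx$ for $s\in[-R,R]$. For $\beta>0$, the model slab $S_\beta(I_{\mathbf T^2})$ is $[0,\beta]\times(-R,R)$ with the Euclidean metric and the probability measure $\mu_\beta=\frac1\beta\varphi(s)\,dt\,ds$. For $0<v_0<v_1<1$ let $\ell(v)=\frac{v_1-v}{v_1-v_0}I(v_0)+\frac{v-v_0}{v_1-v_0}I(v_1)$ be the chord of $I$ between $v_0$ and $v_1$, assume that $\ell<I$ on $(v_0,v_1)$ (equivalently, that $v_0$ and $v_1$ do not both lie in $[\frac1\pi,1-\frac1\pi]$), and set $$\tau(v)=\int_v^{v_1}\frac{d\omega}{I(\omega)\sqrt{(I(\omega)/\ell(\omega))^2-1}},\qquad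 v\in[v_0,v_1].$$ The generalized unduloid in $S_\beta(I_{\mathbf T^2})$ with parameters $v_0,v_1$, which is defined when $\tau(v_0)=\beta$, is the graph $\Sigma$ of the function $f=\Phi^{-1}\circ\tau^{-1}:[0,\beta]\to[-R,R]$. It encloses the weighted volume $\bar v=\mu_\beta\{(t,s)\in[0,\beta]\times(-R,R):\ s\le f(t)\}$. It has weighted mean curvature $\lambda$ if $$\frac{-f''(t)}{(1+f'(t)^2)^{3/2}}+\frac{(\log\varphi)'(f(t))}{(1+f'(t)^2)^{1/2}}=\lambda$$ for every $t\in(0,\beta)$ such that $\varphi$ is differentiable at $f(t)$. **Proposition.** For every $\beta>0$, if $\Sigma$ is a generalized unduloid in $S_\beta(I_{\mathbf T^2})$ with parameters $0<v_0<v_1<1$, having weighted mean curvature $\lambda\ge 0.8$ and enclosing weighted volume $\bar v\le\frac{4\pi}{81}$, then $v_1\le\frac1\pi$. -/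

import Mathlib

open MeasureTheory
open scoped Real

namespace ModelSlab

/-- The isoperimetric profile of the flat torus `ℝ² / (2ℤ²)` with its uniform probability measure,
as a function of the (normalized) volume `v ∈ [0,1]`. -/
noncomputable def torusProfile (v : ℝ) : ℝ :=
  min (min (√(π * v)) 1) (√(π * (1 - v)))

/-- Half the length of the support of the density attached to the torus profile. -/
noncomputable def torusRadius : ℝ := 1 / 2 + 1 / π

/-- The even log-concave probability density on `(-R, R)`, `R = torusRadius`, whose isoperimetric
profile is `torusProfile`. It is piecewise linear: equal to `1` for `|s| ≤ 1/2 - 1/π`, and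
decreasing linearly to `0` at `|s| = R`. It is extended by `0` outside `(-R, R)`. -/
noncomputable def torusDensity (s : ℝ) : ℝ :=
  if |s| ≤ 1 / 2 - 1 / π then 1
  else if |s| < torusRadius then π / 2 * (1 / π + 1 / 2 - |s|)
  else 0

/-- The cumulative distribution function `Φ` of `torusDensity`. -/
noncomputable def torusCDF (s : ℝ) : ℝ := ∫ x in Set.Iic s, torusDensity x

/-- The probability measure of the model slab of width `β` over the torus profile: the product of
the uniform probability measure on `[0, β]` and of `torusDensity s ds` on `(-R, R)`. -/
noncomputable def slabMeasure (β : ℝ) : Measure (ℝ × ℝ) :=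
  (ENNReal.ofReal (1 / β) • (volume.restrict (Set.Icc 0 β))).prod
    ((volume.restrict (Set.Ioo (-torusRadius) torusRadius)).withDensity
      fun s => ENNReal.ofReal (torusDensity s))

/-- The part of the model slab `[0, β] × (-R, R)` that lies below the graph of `f`. -/
def subgraph (β : ℝ) (f : ℝ → ℝ) : Set (ℝ × ℝ) :=
  {p | p.1 ∈ Set.Icc 0 β ∧ p.2 ∈ Set.Ioo (-torusRadius) torusRadius ∧ p.2 ≤ f p.1}

/-- The chord of the torus profile between `v₀` and `v₁`, evaluated at `v`. -/
noncomputable def chord (v₀ v₁ v : ℝ) : ℝ :=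
  (v₁ - v) / (v₁ - v₀) * torusProfile v₀ + (v - v₀) / (v₁ - v₀) * torusProfile v₁

/-- The function `τ(v) = ∫_v^{v₁} dω / (I(ω) √((I(ω)/ℓ(ω))² - 1))`, where `I` is the torus
profile and `ℓ` is its chord between `v₀` and `v₁`. -/
noncomputable def unduloidTime (v₀ v₁ v : ℝ) : ℝ :=
  ∫ w in v..v₁,
    1 / (torusProfile w * √((torusProfile w / chord v₀ v₁ w) ^ 2 - 1))

/-- The half-period `T(v₀, v₁)`, i.e. the value of `τ` at `v₀`. -/
noncomputable def halfPeriod (v₀ v₁ : ℝ) : ℝ := unduloidTime v₀ v₁ v₀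

/-- `f : [0, β] → [-R, R]` is the generalized unduloid, in the model slab of width `β > 0` over the
torus profile, with parameters `0 < v₀ < v₁ < 1`: its half-period is the width of the slab, and
`Φ ∘ f : [0, β] → [v₀, v₁]` is the inverse of `τ : [v₀, v₁] → [0, β]`.
(If `v₀` and `v₁` both lie in the interval `[1/π, 1 - 1/π]` where the profile is constant, then the
chord coincides with the profile and there is no unduloid; in that case `halfPeriod v₀ v₁ = 0`,
so that the definition is not satisfied for any `β > 0`. Otherwise the chord lies strictly
below the strictly positive profile on `(v₀, v₁)`, and the integrals converge.)
Only the values of `f` on `[0, β]` matter. -/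
structure IsGeneralizedUnduloid (β v₀ v₁ : ℝ) (f : ℝ → ℝ) : Prop where
  pos : 0 < v₀
  lt : v₀ < v₁
  lt_one : v₁ < 1
  halfPeriod_eq : halfPeriod v₀ v₁ = β
  mapsTo : ∀ t ∈ Set.Icc 0 β, f t ∈ Set.Icc (-torusRadius) torusRadius
  cdf_mem : ∀ t ∈ Set.Icc 0 β, torusCDF (f t) ∈ Set.Icc v₀ v₁
  time_eq : ∀ t ∈ Set.Icc 0 β, unduloidTime v₀ v₁ (torusCDF (f t)) = t

/-- The weighted mean curvature `H_Σ + ⟨∇ log Ψ, n⟩` at the point `(t, f t)` of the graph `Σ` of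
`f`, with respect to the density `Ψ(t, s) = φ(s) / β` of the slab, where `φ = torusDensity` and
`n = (-f', 1) / √(1 + f'²)` is the unit normal pointing out of the subgraph.
The curvature `H_Σ = -f'' / (1 + f'²)^{3/2}` is positive where `f` is strictly concave. -/
noncomputable def weightedMeanCurvature (f : ℝ → ℝ) (t : ℝ) : ℝ :=
  -deriv (deriv f) t / (√(1 + deriv f t ^ 2)) ^ 3 +
    deriv (fun s => Real.log (torusDensity s)) (f t) / √(1 + deriv f t ^ 2)

/-- The graph of `f` over `(0, β)` has constant weighted mean curvature `l`: the weighted mean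
curvature equals `l` at every point where the density of the slab is differentiable. -/
def HasWeightedMeanCurvature (β : ℝ) (f : ℝ → ℝ) (l : ℝ) : Prop :=
  ∀ t ∈ Set.Ioo 0 β, DifferentiableAt ℝ torusDensity (f t) → weightedMeanCurvature f t = l

end ModelSlab

namespace ModelSlab

/-! Write I for the profile, ℓ for its chord, Φ for the distribution function and c = 4π/81. Since I
∘ Φ = φ, inverting τ ∘ Φ gives √(1 + f'²) = φ/ℓ along Σ. Hence the weighted mean curvature is the
slope of ℓ (`weightedMeanCurvature_eq`). The substitution t = τ(v) turns the volume bound into ∫ (v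
- c) ρ(v) dv ≤ 0 over [v₀, v₁], where ρ is the integrand of τ (`IsGeneralizedUnduloid.integral_le`).
It remains to show that this integral is positive when v₁ > 1/π and the slope is at least 0.8
(`integral_sub_mul_timeDensity_pos`).

Only v₀ < c needs work. Put z = πv, m = πc, u = √(πv₀), and let U be the second root of x = ℓ(x²/π);
then U > 1. Below v = 1/π the density ρ is explicit in z, u, U. On [v₀, c] the weight v - c is
negative and ρ is bounded above, which costs less than 0.432 + 0.29u after scaling by π²
(`left_total_lt`). The volumes above c must repay this. If v₁ lies on the plateau of I, the pieces
[c, 1/π] and [1/π, v₁] together suffice, uniformly in U (`le_right_total`). If v₁ lies beyond the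
plateau, the plateau alone suffices, because there ℓ grows at rate at least 0.8
(`steep_contribution`). -/

/-! ### Numerical estimates -/

/-- The tangent line bound for the logarithm at `6`. -/
theorem log_le_div_six_add {x : ℝ} (hx : 0 < x) : Real.log x ≤ x / 6 + 0.79176 := by
  have h6 : Real.log 6 ≤ 1.79176 := by
    rw [show (6 : ℝ) = 2 * 3 by norm_num, Real.log_mul (by norm_num) (by norm_num)]
    have := Real.log_two_lt_d9
    have := Real.log_three_lt_d9
    linarith
  have h := Real.log_le_sub_one_of_pos (show 0 < x / 6 by positivity)
  rw [Real.log_div hx.ne' (by norm_num)] at h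
  linarith

theorem four_mul_pi_sq_bounds : 0.48738 < 4 * π ^ 2 / 81 ∧ 4 * π ^ 2 / 81 < 0.4874 := by
  have h1 := Real.pi_gt_d6
  have h2 := Real.pi_lt_d6
  constructor <;> nlinarith

/-- In `left_total_lt` the cost is bounded by A + B r. This treats A, which is enough when B ≤ 0.
The decimals round m = 4π²/81 and 2π/9 up. -/
theorem poly_bound_const {u : ℝ} (h0 : 0 ≤ u) (h1 : u ≤ 0.699) :
    (0.79176 * u + 0.69815 / 6) * (0.9748 + (0.4874 * (1 + 0.815 * (u + 0.4874)) - u) * u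
      - 0.75 * (1 + 0.815 * (u + 0.4874)) * u ^ 3) < 0.432 + 0.29 * u := by
  nlinarith [mul_nonneg h0 (sub_nonneg.2 h1), sq_nonneg (u - 0.4), sq_nonneg (u ^ 2 - 0.2),
    mul_nonneg h0 (sq_nonneg (u - 0.4)), mul_nonneg h0 (sq_nonneg (u ^ 2)),
    mul_nonneg (mul_nonneg h0 h0) (sub_nonneg.2 h1), pow_nonneg h0 3, pow_nonneg h0 5]

/-- The case B > 0: r is replaced by a tangent bound. The two sides are closest near u = 0.2, which
guides the tangency points used for r and for the logarithm. -/
theorem poly_bound_main {u : ℝ} (h0 : 0 ≤ u) (h1 : u ≤ 0.45) :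
    (0.79176 * u + 0.69815 / 6) * (0.9748 + (0.4874 * (1 + 0.815 * (u + 0.4874)) - u) * u
      - 0.75 * (1 + 0.815 * (u + 0.4874)) * u ^ 3)
    + ((0.9748 + (0.4874 * (1 + 0.815 * (u + 0.4874)) - u) * u
      - 0.75 * (1 + 0.815 * (u + 0.4874)) * u ^ 3) / 6
      + 0.69815 / 2 * 0.4874 * (1 + 0.815 * (u + 0.4874))
      - 0.6981 * (u + 0.75 * (1 + 0.815 * (u + 0.4874)) * u ^ 2)) * ((0.935 - u ^ 2) / 1.338)
      < 0.432 + 0.29 * u := by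
  have hc : 0 < 0.0389 - 0.24945 * u + 0.4114 * u ^ 2 + 0.686 * u ^ 3 := by
    nlinarith [sq_nonneg (u - 0.19),
      mul_nonneg (by linarith : 0 ≤ u + 0.38) (sq_nonneg (u - 0.19))]
  have hq : 0 ≤ 0.35 + 0.0345 * u - 0.0762 * u ^ 2 := by nlinarith
  have h4 := mul_nonneg (pow_nonneg h0 4) hq
  have h6 := pow_nonneg h0 6
  ring_nf at hc h4 ⊢
  linarith [pow_nonneg h0 2, pow_nonneg h0 3, pow_nonneg h0 4, pow_nonneg h0 5]

theorem poly_coeff_nonpos {u : ℝ} (h0 : 0.45 ≤ u) :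
    ((0.9748 + (0.4874 * (1 + 0.815 * (u + 0.4874)) - u) * u
      - 0.75 * (1 + 0.815 * (u + 0.4874)) * u ^ 3) / 6
      + 0.69815 / 2 * 0.4874 * (1 + 0.815 * (u + 0.4874))
      - 0.6981 * (u + 0.75 * (1 + 0.815 * (u + 0.4874)) * u ^ 2)) ≤ 0 := by
  nlinarith [sq_nonneg (u - 0.45), pow_nonneg (by linarith : 0 ≤ u) 3,
    pow_nonneg (by linarith : 0 ≤ u) 4]

/-- The upper bound for the contribution of small volumes. -/
theorem left_total_lt {u r : ℝ} (h0 : 0 < u) (h1 : u < 2 * π / 9) (hr : 0 ≤ r)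
    (hr2 : r ^ 2 = 4 * π ^ 2 / 81 - u ^ 2) {s L : ℝ} (hs : s = 1 + 0.815 * (u + 0.4874))
    (hL : L = Real.log ((2 * π / 9 + r) / u)) :
    2 * (4 * π ^ 2 / 81) * u * L + (4 * π ^ 2 / 81 * s - u) * (2 * π / 9 * r + u ^ 2 * L)
      - s * (4 * π ^ 2 / 81 * (2 * π / 9 * r) / 2 + 3 / 4 * u ^ 2 * (2 * π / 9 * r)
        + 3 / 4 * u ^ 4 * L) < 0.432 + 0.29 * u := by
  have hpi := Real.pi_gt_d6
  have hpi' := Real.pi_lt_d6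
  obtain ⟨hm1, hm2⟩ := four_mul_pi_sq_bounds
  generalize hm : 4 * π ^ 2 / 81 = m at *
  have hc1 : 0.6981 ≤ 2 * π / 9 := by linarith
  have hc2 : 2 * π / 9 ≤ 0.69815 := by linarith
  generalize hc : 2 * π / 9 = c at *
  have hu : u ≤ 0.699 := by linarith
  have hs1 : 1 ≤ s := by rw [hs]; linarith
  have hs2 : s ≤ 2 := by rw [hs]; linarith
  -- Multiplying the tangent bound by u removes the logarithmic singularity at u = 0 and leaves an
  -- expression affine in r.
  have hL' : u * L ≤ (c + r) / 6 + 0.79176 * u := by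
    have h := log_le_div_six_add (show 0 < (c + r) / u by positivity)
    rw [← hL] at h
    calc u * L ≤ u * ((c + r) / u / 6 + 0.79176) := by gcongr
      _ = _ := by field_simp
  obtain ⟨C, hC⟩ : ∃ x, x = 2 * m + (m * s - u) * u - 3 / 4 * s * u ^ 3 := ⟨_, rfl⟩
  obtain ⟨C', hC'⟩ : ∃ x, x = 0.9748 + (0.4874 * s - u) * u - 0.75 * s * u ^ 3 := ⟨_, rfl⟩
  have hu3 : u ^ 3 ≤ 0.699 ^ 2 * u := by
    have : u ^ 2 ≤ 0.699 ^ 2 := by gcongr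
    nlinarith
  have hC0 : 0 ≤ C := by
    have h1 : s * u ^ 3 ≤ 2 * u ^ 3 := by gcongr
    have h2 : 0 ≤ m * s * u := by positivity
    nlinarith
  have hCC : C ≤ C' := by
    have : m * s * u ≤ 0.4874 * s * u := by gcongr
    rw [hC, hC']; nlinarith
  have hC0' : 0 ≤ C' := hC0.trans hCC
  obtain ⟨B, hB⟩ : ∃ x, x =
    C' / 6 + 0.69815 / 2 * 0.4874 * s - 0.6981 * (u + 0.75 * s * u ^ 2) := ⟨_, rfl⟩
  obtain ⟨A, hA⟩ : ∃ x, x = (0.79176 * u + 0.69815 / 6) * C' := ⟨_, rfl⟩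
  have key : 2 * m * u * L + (m * s - u) * (c * r + u ^ 2 * L)
      - s * (m * (c * r) / 2 + 3 / 4 * u ^ 2 * (c * r) + 3 / 4 * u ^ 4 * L) ≤ A + B * r := by
    have e1 : 2 * m * u * L + (m * s - u) * (c * r + u ^ 2 * L)
      - s * (m * (c * r) / 2 + 3 / 4 * u ^ 2 * (c * r) + 3 / 4 * u ^ 4 * L)
      = C * (u * L) + r * (c * (m * s / 2) - c * (u + 3 / 4 * s * u ^ 2)) := by rw [hC]; ring
    have e2 : C * (u * L) ≤ C' * ((0.69815 + r) / 6 + 0.79176 * u) := by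
      calc C * (u * L) ≤ C * ((0.69815 + r) / 6 + 0.79176 * u) := by
            refine mul_le_mul_of_nonneg_left (hL'.trans ?_) hC0
            gcongr
        _ ≤ _ := by gcongr
    have e3 : c * (m * s / 2) ≤ 0.69815 * (0.4874 * s / 2) := by gcongr
    have e4 : 0.6981 * (u + 3 / 4 * s * u ^ 2) ≤ c * (u + 3 / 4 * s * u ^ 2) := by gcongr
    have e5 : r * (c * (m * s / 2) - c * (u + 3 / 4 * s * u ^ 2)) ≤
      r * (0.69815 * (0.4874 * s / 2) - 0.6981 * (u + 3 / 4 * s * u ^ 2)) := by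
      gcongr
    rw [e1]
    refine (add_le_add e2 e5).trans (le_of_eq ?_)
    rw [hA, hB]; ring
  refine key.trans_lt ?_
  have hA' : A < 0.432 + 0.29 * u := by
    have := poly_bound_const h0.le hu
    rw [hA, hC', hs]
    exact this
  -- The bound is affine in r: for B ≤ 0 the term B r is dropped; B > 0 forces u ≤ 0.45, and r is
  -- then bounded above.
  rcases le_or_gt B 0 with hB0 | hB0
  · nlinarith [mul_nonneg (neg_nonneg.2 hB0) hr]
  · have hu' : u ≤ 0.45 := by
      by_contra! h
      have := poly_coeff_nonpos h.le
      rw [hB, hC', hs] at hB0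
      exact absurd this (not_le.2 hB0)
    -- From 2 · 0.669 r ≤ r² + 0.669², where 0.669 approximates r at u = 0.2.
    have hr' : r ≤ (0.935 - u ^ 2) / 1.338 := by
      rw [le_div_iff₀ (by norm_num)]
      nlinarith [sq_nonneg (r - 0.669)]
    have h := poly_bound_main h0.le hu'
    have : B * r ≤ B * ((0.935 - u ^ 2) / 1.338) := by gcongr
    refine (add_le_add_right this A).trans_lt ?_
    rw [hA, hB, hC', hs]
    exact h

/-- The lower bound for the contribution of large volumes. -/
theorem le_right_total {u q q' w δ : ℝ} (h0 : 0 ≤ u) (h1 : u ≤ 0.699)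
    (hw : w = √(1 - u ^ 2)) (hqq : q < q') (hδ : q' ^ 2 = q ^ 2 + δ) (hδ' : 0.5126 ≤ δ) :
    0.432 + 0.29 * u ≤
      2 / 3 * ((1 + u) / w) * ((q' - q) ^ 2 * (2 * q' + q)) + δ * (q * w) := by
  obtain ⟨a, ha, ha2⟩ : ∃ a, 0 < a ∧ a ^ 2 = 1 - u :=
    ⟨√(1 - u), Real.sqrt_pos.2 (by linarith), Real.sq_sqrt (by linarith)⟩
  obtain ⟨b, hb, hb2⟩ : ∃ b, 0 < b ∧ b ^ 2 = 1 + u :=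
    ⟨√(1 + u), Real.sqrt_pos.2 (by linarith), Real.sq_sqrt (by linarith)⟩
  have hwab : w = a * b := by
    rw [hw, show 1 - u ^ 2 = (a * b) ^ 2 by rw [mul_pow, ha2, hb2]; ring,
      Real.sqrt_sq (by positivity)]
  obtain ⟨σ, hσ, hσ2⟩ : ∃ σ, 0 < σ ∧ σ ^ 2 = δ / 2 :=
    ⟨√(δ / 2), Real.sqrt_pos.2 (by linarith), Real.sq_sqrt (by linarith)⟩
  have hσ' : 0.5062 ≤ σ := by nlinarith
  have hb' : 1 + u / 2 - u ^ 2 / 8 ≤ b := by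
    refine le_of_sq_le_sq ?_ hb.le
    rw [hb2]
    nlinarith [pow_nonneg h0 3, mul_nonneg (pow_nonneg h0 3) (by linarith : 0 ≤ 1 - u)]
  set d := q' - q with hd
  have hd0 : 0 < d := by linarith
  have hq' : q' = q + d := by rw [hd]; ring
  have hδe : δ = 2 * q * d + d ^ 2 := by rw [hq'] at hδ; linarith
  have hσe : σ ^ 2 = (2 * q * d + d ^ 2) / 2 := by rw [hσ2, hδe]
  -- With δ fixed, the right side depends only on d and is smallest at d = aσ; the difference is (d
  -- - aσ)² times a positive factor. This removes all dependence on q, hence on U.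
  have hmain : σ * δ * (5 + u) / 3 * a ≤ 2 / 3 * (d ^ 2 * (2 * q' + q)) + δ * q * a ^ 2 := by
    have e : 2 / 3 * (d ^ 2 * (2 * q' + q)) + δ * q * a ^ 2 - σ * δ * (5 + u) / 3 * a =
      (d - a * σ) ^ 2 * (δ / d + (d + 2 * (a * σ)) / 3) := by
      have hu : u = 1 - a ^ 2 := by linarith
      rw [hu, hδe, hq']
      field_simp
      have : σ ^ 3 = σ * ((2 * q * d + d ^ 2) / 2) := by rw [← hσe]; ring
      ring_nf
      ring_nf at this hσe
      simp only [this, hσe]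
      ring
    have : 0 ≤ (d - a * σ) ^ 2 * (δ / d + (d + 2 * (a * σ)) / 3) := by
      have : 0 < δ := by linarith
      positivity
    linarith
  have hfin : 0.432 + 0.29 * u ≤ b * (σ * δ * (5 + u) / 3) := by
    have h2 : 0.5062 * 0.5126 ≤ σ * δ := by gcongr
    have h3 : 0 ≤ 1 + u / 2 - u ^ 2 / 8 := by nlinarith
    calc 0.432 + 0.29 * u ≤ (1 + u / 2 - u ^ 2 / 8) * (0.5062 * 0.5126 * (5 + u) / 3) := by
          nlinarith [mul_nonneg h0 (sub_nonneg.2 h1),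
            mul_nonneg (mul_nonneg h0 h0) (sub_nonneg.2 h1)]
      _ ≤ _ := by gcongr
  refine hfin.trans ?_
  have e : 2 / 3 * ((1 + u) / w) * (d ^ 2 * (2 * q' + q)) + δ * (q * w) =
      b / a * (2 / 3 * (d ^ 2 * (2 * q' + q)) + δ * q * a ^ 2) := by
    rw [hwab, ← hb2]; field_simp
  rw [e]
  calc b * (σ * δ * (5 + u) / 3) = b / a * (σ * δ * (5 + u) / 3 * a) := by field_simp
    _ ≤ _ := by gcongr

/-! ### Pointwise bounds for the integrand where the profile is a square root -/

/-- The worst case is U = 1. Then 1/√(1 - z) is bounded by 1 + 0.815z, where 0.815 is its chord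
slope on [0, 0.4874] rounded up, and z² by 0.4874z. -/
theorem left_factor_le {u U z m s : ℝ} (hu : 0 ≤ u) (hU : 1 ≤ U) (hz : 0 ≤ z) (hzm : z ≤ m)
    (hm : m ≤ 0.4874) (hs : s = 1 + 0.815 * (u + 0.4874)) :
    (z + u * U) / √(U ^ 2 - z) ≤ u + s * z := by
  have h1 : 0 < 1 - z := by linarith
  have hU2 : 0 < U ^ 2 - z := by nlinarith
  have hpos : 0 ≤ 1 + 0.815 * z := by linarith
  have step1 : (z + u * U) ^ 2 * (1 - z) ≤ (z + u) ^ 2 * (U ^ 2 - z) := by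
    have e : (z + u) ^ 2 * (U ^ 2 - z) - (z + u * U) ^ 2 * (1 - z) =
      (U - 1) * (z * ((U - 1) * (z + 2 * u + u ^ 2) + 2 * (z + u + u ^ 2) + 2 * u * z)) := by ring
    have h : 0 ≤ U - 1 := by linarith
    have : 0 ≤ (U - 1) * (z * ((U - 1) * (z + 2 * u + u ^ 2) + 2 * (z + u + u ^ 2) + 2 * u * z)) := by
      positivity
    linarith
  have step2 : 1 ≤ (1 + 0.815 * z) ^ 2 * (1 - z) := by
    have : 0 ≤ z * (0.63 - 0.965775 * z - 0.664225 * z ^ 2) := by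
      apply mul_nonneg hz; nlinarith
    nlinarith
  rw [div_le_iff₀ (Real.sqrt_pos.2 hU2)]
  have h3 : (z + u) * (1 + 0.815 * z) ≤ u + s * z := by rw [hs]; nlinarith
  calc z + u * U ≤ (z + u) * (1 + 0.815 * z) * √(U ^ 2 - z) := by
        apply le_of_sq_le_sq _ (by positivity)
        rw [mul_pow, Real.sq_sqrt hU2.le, mul_pow]
        have : (z + u * U) ^ 2 * (1 - z) * 1 ≤
            (z + u) ^ 2 * (U ^ 2 - z) * ((1 + 0.815 * z) ^ 2 * (1 - z)) := by
          gcongr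
        nlinarith
    _ ≤ _ := by gcongr

/-- The right side is smallest at U = 1 and z = 1. -/
theorem le_right_factor {u U z w : ℝ} (hu : 0 < u) (hU : 1 ≤ U) (huz : u ^ 2 < z) (hz1 : z ≤ 1)
    (hw : w = √(1 - u ^ 2)) :
    (1 + u) / w ≤ (z + u * U) / (√z * √(z - u ^ 2)) := by
  have hz : 0 < z := by nlinarith
  have hu1 : u < 1 := by nlinarith
  have h1 : 0 < 1 - u ^ 2 := by nlinarith
  have h2 : 0 < z - u ^ 2 := by linarith
  rw [hw, div_le_div_iff₀ (Real.sqrt_pos.2 h1)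
    (mul_pos (Real.sqrt_pos.2 hz) (Real.sqrt_pos.2 h2))]
  have h3 : z + u ≤ z + u * U := by nlinarith
  refine le_trans ?_ (mul_le_mul_of_nonneg_right h3 (Real.sqrt_nonneg _))
  apply le_of_sq_le_sq _ (by positivity)
  rw [mul_pow, mul_pow, mul_pow, Real.sq_sqrt hz.le, Real.sq_sqrt h2.le, Real.sq_sqrt h1.le]
  have e : (z + u) ^ 2 * (1 - u ^ 2) - (1 + u) ^ 2 * (z * (z - u ^ 2)) =
    (1 + u) * ((1 - z) * (2 * u * z + u ^ 2 * (1 - u))) := by ring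
  have : 0 ≤ (1 + u) * ((1 - z) * (2 * u * z + u ^ 2 * (1 - u))) := by
    have : 0 ≤ 1 - z := by linarith
    have : 0 ≤ 1 - u := by linarith
    positivity
  linarith

/-! ### Antiderivatives -/

/-- An antiderivative of `(m - z) (u + s z) / √(z (z - u²))`. -/
noncomputable def leftPrimitive (m u s z : ℝ) : ℝ :=
  2 * m * u * Real.log (√z + √(z - u ^ 2))
    + (m * s - u) * (√z * √(z - u ^ 2) + u ^ 2 * Real.log (√z + √(z - u ^ 2)))
    - s * (z * (√z * √(z - u ^ 2)) / 2 + 3 / 4 * u ^ 2 * (√z * √(z - u ^ 2))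
      + 3 / 4 * u ^ 4 * Real.log (√z + √(z - u ^ 2)))

theorem hasDerivAt_leftPrimitive {m u s z : ℝ} (h : u ^ 2 < z) :
    HasDerivAt (leftPrimitive m u s) ((m - z) * (u + s * z) / (√z * √(z - u ^ 2))) z := by
  have hz : 0 < z := (sq_nonneg u).trans_lt h
  have h2 : 0 < z - u ^ 2 := by linarith
  have ha := Real.sqrt_pos.2 hz
  have hb := Real.sqrt_pos.2 h2
  have ha2 := Real.sq_sqrt hz.le
  have hb2 := Real.sq_sqrt h2.le
  have d1 : HasDerivAt (fun z => √z) (1 / (2 * √z)) z := (hasDerivAt_id z).sqrt hz.ne'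
  have d2 : HasDerivAt (fun z => √(z - u ^ 2)) (1 / (2 * √(z - u ^ 2))) z :=
    ((hasDerivAt_id z).sub_const (u ^ 2)).sqrt h2.ne'
  have d3 := (d1.add d2).log (by simp only [Pi.add_apply]; positivity)
  have d4 := d1.mul d2
  have d5 := (((d3.const_mul (2 * m * u)).add ((d4.add (d3.const_mul (u ^ 2))).const_mul
    (m * s - u))).sub (((((hasDerivAt_id z).mul d4).div_const 2).add
      (d4.const_mul (3 / 4 * u ^ 2))).add (d3.const_mul (3 / 4 * u ^ 4)) |>.const_mul s))
  refine d5.congr_deriv ?_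
  simp only [Pi.add_apply, Pi.mul_apply, id]
  set a := √z
  set b := √(z - u ^ 2)
  have hu : u ^ 2 = a ^ 2 - b ^ 2 := by rw [ha2, hb2]; ring
  have hu4 : u ^ 4 = (a ^ 2 - b ^ 2) ^ 2 := by rw [← hu]; ring
  rw [hu4, hu, ← ha2]
  field_simp
  ring

theorem continuousOn_leftPrimitive {m u s : ℝ} (hu : 0 < u) :
    ContinuousOn (leftPrimitive m u s) (Set.Ici (u ^ 2)) := by
  have hl : ContinuousOn (fun z => Real.log (√z + √(z - u ^ 2))) (Set.Ici (u ^ 2)) := by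
    refine ContinuousOn.log (by fun_prop) fun z hz => ?_
    have : 0 < z := (by positivity : 0 < u ^ 2).trans_le hz
    positivity
  unfold leftPrimitive
  fun_prop

theorem leftPrimitive_sub {m u s c : ℝ} (hu : 0 < u) (hc : 0 < c) (hm : m = c ^ 2) :
    leftPrimitive m u s m - leftPrimitive m u s (u ^ 2) =
      2 * m * u * Real.log ((c + √(m - u ^ 2)) / u)
        + (m * s - u) * (c * √(m - u ^ 2) + u ^ 2 * Real.log ((c + √(m - u ^ 2)) / u))
      - s * (m * (c * √(m - u ^ 2)) / 2 + 3 / 4 * u ^ 2 * (c * √(m - u ^ 2))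
        + 3 / 4 * u ^ 4 * Real.log ((c + √(m - u ^ 2)) / u)) := by
  have h1 : √m = c := by rw [hm, Real.sqrt_sq hc.le]
  rw [Real.log_div (by positivity) hu.ne']
  simp only [leftPrimitive, h1, Real.sqrt_sq hu.le, sub_self, Real.sqrt_zero, mul_zero, add_zero,
    zero_add]
  ring

/-- An antiderivative of `(z - m) / √(A - z)`. -/
noncomputable def rightPrimitive (m A z : ℝ) : ℝ :=
  -2 * (A - m) * √(A - z) + 2 / 3 * √(A - z) ^ 3

theorem hasDerivAt_rightPrimitive {m A z : ℝ} (h : z < A) :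
    HasDerivAt (rightPrimitive m A) ((z - m) / √(A - z)) z := by
  have h2 : 0 < A - z := by linarith
  have hb := Real.sqrt_pos.2 h2
  have hb2 := Real.sq_sqrt h2.le
  have d2 : HasDerivAt (fun z => √(A - z)) (-1 / (2 * √(A - z))) z :=
    ((hasDerivAt_id z).const_sub A).sqrt h2.ne'
  have d5 := (d2.const_mul (-2 * (A - m))).add ((d2.pow 3).const_mul (2 / 3))
  refine d5.congr_deriv ?_
  have : z = A - √(A - z) ^ 2 := by rw [hb2]; ring
  set b := √(A - z)
  rw [this]
  field_simp
  push_cast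
  ring

theorem continuous_rightPrimitive {m A : ℝ} : Continuous (rightPrimitive m A) := by
  unfold rightPrimitive
  fun_prop

theorem rightPrimitive_sub {m A : ℝ} (hm : m ≤ A) :
    rightPrimitive m A 1 - rightPrimitive m A m =
      2 / 3 * ((√(A - m) - √(A - 1)) ^ 2 * (2 * √(A - m) + √(A - 1))) := by
  have h1 := Real.sq_sqrt (sub_nonneg.2 hm)
  unfold rightPrimitive
  set p := √(A - m)
  rw [← h1]
  ring

/-! ### Lower bounds for integrals -/

/-- The substitution z = πv produces the factor π². Comparing with a primitive continuous up to v₀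
avoids proving integrability of the bound, which is singular there. -/
theorem left_integral_ge {φ : ℝ → ℝ} {m u s v₀ c : ℝ} (hu : 0 < u) (hv₀ : π * v₀ = u ^ 2)
    (hc : π * c = m) (h : v₀ ≤ c) (hφ : IntegrableOn φ (Set.Icc v₀ c))
    (hle : ∀ v ∈ Set.Ioo v₀ c,
      (v - c) * ((u + s * (π * v)) / (√(π * v) * √(π * v - u ^ 2))) ≤ φ v) :
    -(leftPrimitive m u s m - leftPrimitive m u s (u ^ 2)) ≤ π ^ 2 * ∫ v in v₀..c, φ v := by
  have hpi := Real.pi_pos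
  have key := intervalIntegral.sub_le_integral_of_hasDeriv_right_of_le
    (g := fun v => -(leftPrimitive m u s (π * v) / π ^ 2))
    (g' := fun v => (v - c) * ((u + s * (π * v)) / (√(π * v) * √(π * v - u ^ 2)))) h ?_ ?_ hφ hle
  · simp only [hv₀, hc] at key
    calc _ = π ^ 2 * (-(leftPrimitive m u s m / π ^ 2) -
          -(leftPrimitive m u s (u ^ 2) / π ^ 2)) := by field_simp; ring
      _ ≤ _ := by gcongr
  · refine (ContinuousOn.div_const ((continuousOn_leftPrimitive hu).comp
      (f := fun v => π * v) (by fun_prop) fun v hv => ?_) _).neg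
    rw [Set.mem_Ici, ← hv₀]
    exact mul_le_mul_of_nonneg_left hv.1 hpi.le
  · intro v hv
    have hv' : u ^ 2 < π * v := by rw [← hv₀]; exact mul_lt_mul_of_pos_left hv.1 hpi
    have d : HasDerivAt (fun v : ℝ => π * v) π v := by
      simpa using (hasDerivAt_id v).const_mul π
    have := (((hasDerivAt_leftPrimitive (m := m) (s := s) hv').comp v d).div_const (π ^ 2)).neg
    refine (this.congr_deriv ?_).hasDerivWithinAt
    rw [← hc]
    field_simp
    ring

theorem right_integral_ge {φ : ℝ → ℝ} {m A N c : ℝ} (hc : π * c = m) (hm : m ≤ 1) (hA : 1 < A)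
    (hφ : IntegrableOn φ (Set.Icc c (1 / π)))
    (hle : ∀ v ∈ Set.Ioo c (1 / π), (v - c) * (N / √(A - π * v)) ≤ φ v) :
    N * (rightPrimitive m A 1 - rightPrimitive m A m) ≤ π ^ 2 * ∫ v in c..(1 / π), φ v := by
  have hpi := Real.pi_pos
  have h : c ≤ 1 / π := by rw [le_div_iff₀ hpi]; linarith
  have key := intervalIntegral.sub_le_integral_of_hasDeriv_right_of_le
    (g := fun v => N * (rightPrimitive m A (π * v) / π ^ 2))
    (g' := fun v => (v - c) * (N / √(A - π * v))) h ?_ ?_ hφ hle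
  · simp only [mul_one_div_cancel hpi.ne', hc] at key
    calc _ = π ^ 2 * (N * (rightPrimitive m A 1 / π ^ 2) -
          N * (rightPrimitive m A m / π ^ 2)) := by field_simp
      _ ≤ _ := by gcongr
  · exact (((continuous_rightPrimitive.comp (by fun_prop)).div_const _).const_mul _).continuousOn
  · intro v hv
    have hv' : π * v < A := by
      have := (lt_div_iff₀ hpi).1 hv.2
      linarith
    have d : HasDerivAt (fun v : ℝ => π * v) π v := by
      simpa using (hasDerivAt_id v).const_mul π
    have := (((hasDerivAt_rightPrimitive (m := m) hv').comp v d).div_const (π ^ 2)).const_mul N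
    refine (this.congr_deriv ?_).hasDerivWithinAt
    rw [← hc]
    field_simp

/-- Here 1 - k(b - v) plays the role of a chord ℓ reaching the plateau height 1 at b, and -√(1 -
ℓ²)/k is a primitive of ℓ/√(1 - ℓ²). -/
theorem plateau_integral_ge {φ : ℝ → ℝ} {a b K k : ℝ} (hab : a ≤ b) (hk : 0 < k)
    (hφ : IntegrableOn φ (Set.Icc a b)) (hpos : 0 < 1 - k * (b - a))
    (hle : ∀ v ∈ Set.Ioo a b, K * ((1 - k * (b - v)) / √(1 - (1 - k * (b - v)) ^ 2)) ≤ φ v) :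
    K / k * √(1 - (1 - k * (b - a)) ^ 2) ≤ ∫ v in a..b, φ v := by
  have key := intervalIntegral.sub_le_integral_of_hasDeriv_right_of_le
    (g := fun v => -(K / k * √(1 - (1 - k * (b - v)) ^ 2)))
    (g' := fun v => K * ((1 - k * (b - v)) / √(1 - (1 - k * (b - v)) ^ 2))) hab
    (by fun_prop) ?_ hφ hle
  · simpa using key
  · intro v hv
    have h1 : 0 < k * (b - v) := mul_pos hk (by linarith [hv.2])
    have h2 : k * (b - v) < k * (b - a) := mul_lt_mul_of_pos_left (by linarith [hv.1]) hk
    have h3 : 0 < 1 - (1 - k * (b - v)) ^ 2 := by nlinarith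
    have d : HasDerivAt (fun v : ℝ => 1 - k * (b - v)) k v := by
      simpa using (((hasDerivAt_id v).const_sub b).const_mul k).const_sub 1
    have := (((d.pow 2).const_sub 1).sqrt h3.ne').const_mul (K / k) |>.neg
    refine (this.congr_deriv ?_).hasDerivWithinAt
    have := Real.sqrt_pos.2 h3
    simp only [Pi.pow_apply]
    field_simp
    push_cast
    ring

theorem steep_integral_ge {φ : ℝ → ℝ} {a b c g : ℝ} (hab : a ≤ b)
    (hφ : IntegrableOn φ (Set.Icc a b)) (hle : ∀ v ∈ Set.Ioo a b, (v - c) * (0.8 * v + g) ≤ φ v) :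
    0.8 * ((b ^ 3 - a ^ 3) / 3 - c * (b ^ 2 - a ^ 2) / 2)
      + g * ((b ^ 2 - a ^ 2) / 2 - c * (b - a)) ≤ ∫ v in a..b, φ v := by
  have key := intervalIntegral.sub_le_integral_of_hasDeriv_right_of_le
    (g := fun v => 0.8 * (v ^ 3 / 3 - c * v ^ 2 / 2) + g * (v ^ 2 / 2 - c * v))
    (g' := fun v => (v - c) * (0.8 * v + g)) hab (by fun_prop) ?_ hφ hle
  · refine le_trans (le_of_eq ?_) key
    ring
  · intro v _
    have d := hasDerivAt_id v
    have := ((((d.pow 3).div_const 3).sub (((d.pow 2).const_mul c).div_const 2)).const_mul 0.8).add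
      ((((d.pow 2).div_const 2).sub (d.const_mul c)).const_mul g)
    refine (this.congr_deriv ?_).hasDerivWithinAt
    simp only [id]
    push_cast
    ring

/-! ### The torus profile and its chords -/

theorem one_div_pi_lt : 1 / π < 0.3184 := by
  rw [div_lt_iff₀ Real.pi_pos]
  linarith [Real.pi_gt_d6]

theorem lt_one_div_pi : 0.3183 < 1 / π := by
  rw [lt_div_iff₀ Real.pi_pos]
  linarith [Real.pi_lt_d6]

theorem torusProfile_nonneg (v : ℝ) : 0 ≤ torusProfile v := by
  unfold torusProfile; positivity

theorem torusProfile_pos {v : ℝ} (h0 : 0 < v) (h1 : v < 1) : 0 < torusProfile v := by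
  have : 0 < π * (1 - v) := mul_pos Real.pi_pos (by linarith)
  have : 0 < π * v := mul_pos Real.pi_pos h0
  unfold torusProfile; positivity

theorem torusProfile_le_one (v : ℝ) : torusProfile v ≤ 1 :=
  (min_le_left _ _).trans (min_le_right _ _)

theorem torusProfile_le_left (v : ℝ) : torusProfile v ≤ √(π * v) :=
  (min_le_left _ _).trans (min_le_left _ _)

theorem torusProfile_le_right (v : ℝ) : torusProfile v ≤ √(π * (1 - v)) := min_le_right _ _

theorem continuous_torusProfile : Continuous torusProfile := by
  unfold torusProfile; fun_prop

theorem torusProfile_of_le {v : ℝ} (h : v ≤ 1 / π) : torusProfile v = √(π * v) := by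
  have hpi := Real.pi_gt_three
  have h1 : √(π * v) ≤ 1 := by
    rw [Real.sqrt_le_iff]
    rw [le_div_iff₀ Real.pi_pos] at h
    exact ⟨zero_le_one, by linarith⟩
  have h2 : √(π * v) ≤ √(π * (1 - v)) := by
    apply Real.sqrt_le_sqrt
    rw [le_div_iff₀ Real.pi_pos] at h
    linarith
  rw [torusProfile, min_eq_left h1, min_eq_left h2]

theorem torusProfile_one_sub (v : ℝ) : torusProfile (1 - v) = torusProfile v := by
  rw [torusProfile, torusProfile, sub_sub_cancel, min_right_comm, min_comm _ (√(π * v)),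
    min_right_comm]

theorem torusProfile_of_ge {v : ℝ} (h : 1 - 1 / π ≤ v) : torusProfile v = √(π * (1 - v)) := by
  rw [← torusProfile_one_sub, torusProfile_of_le (by linarith)]

theorem torusProfile_of_mem {v : ℝ} (h : 1 / π ≤ v) (h' : v ≤ 1 - 1 / π) : torusProfile v = 1 := by
  have hpi := Real.pi_pos
  have h1 : 1 ≤ √(π * v) := by
    rw [Real.one_le_sqrt]
    rwa [div_le_iff₀' hpi] at h
  have h2 : 1 ≤ √(π * (1 - v)) := by
    rw [Real.one_le_sqrt, ← div_le_iff₀' hpi]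
    linarith
  rw [torusProfile, min_eq_right h1, min_eq_left h2]

theorem torusProfile_lt_one_of_lt {v : ℝ} (h : v < 1 / π) : torusProfile v < 1 := by
  refine (torusProfile_le_left v).trans_lt ?_
  rw [lt_div_iff₀' Real.pi_pos] at h
  rwa [Real.sqrt_lt' one_pos, one_pow]

theorem torusProfile_lt_one_of_gt {v : ℝ} (h : 1 - 1 / π < v) : torusProfile v < 1 := by
  refine (torusProfile_le_right v).trans_lt ?_
  rwa [Real.sqrt_lt' one_pos, one_pow, ← lt_div_iff₀' Real.pi_pos, sub_lt_comm]

section Chord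

variable {v₀ v₁ v : ℝ}

theorem chord_eq (h : v₀ < v₁) (v : ℝ) : chord v₀ v₁ v =
    torusProfile v₀ + (torusProfile v₁ - torusProfile v₀) / (v₁ - v₀) * (v - v₀) := by
  have : v₁ - v₀ ≠ 0 := by linarith
  unfold chord
  field_simp
  ring

theorem chord_pos (h0 : 0 < v₀) (h : v₀ < v₁) (h1 : v₁ < 1) (hv : v ∈ Set.Ioo v₀ v₁) :
    0 < chord v₀ v₁ v := by
  have := torusProfile_pos h0 (h.trans h1)
  have := torusProfile_pos (h0.trans h) h1
  have : 0 < v₁ - v := by linarith [hv.2]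
  have : 0 < v - v₀ := by linarith [hv.1]
  have : 0 < v₁ - v₀ := by linarith
  unfold chord
  positivity

theorem strict_concave_sqrt_mul {p q a b : ℝ} (hp : 0 ≤ p) (hq : 0 ≤ q) (hpq : p ≠ q) (ha : 0 < a)
    (hb : 0 < b) (hab : a + b = 1) : a * √(π * p) + b * √(π * q) < √(π * (a * p + b * q)) := by
  have hpi := Real.pi_pos
  have := Real.strictConcaveOn_sqrt.2 (x := π * p) (y := π * q) (Set.mem_Ici.2 (by positivity))
    (Set.mem_Ici.2 (by positivity)) (by simpa [hpi.ne'] using hpq) ha hb hab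
  simp only [smul_eq_mul] at this
  rwa [show π * (a * p + b * q) = a * (π * p) + b * (π * q) by ring]

/-- A chord of the profile that is not contained in the plateau lies strictly below it. -/
theorem chord_lt_torusProfile (h0 : 0 < v₀) (h : v₀ < v₁) (h1 : v₁ < 1)
    (hp : v₀ < 1 / π ∨ 1 - 1 / π < v₁) (hv : v ∈ Set.Ioo v₀ v₁) :
    chord v₀ v₁ v < torusProfile v := by
  have hd : 0 < v₁ - v₀ := by linarith
  obtain ⟨a, ha⟩ : ∃ a, a = (v₁ - v) / (v₁ - v₀) := ⟨_, rfl⟩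
  obtain ⟨b, hb⟩ : ∃ b, b = (v - v₀) / (v₁ - v₀) := ⟨_, rfl⟩
  have ha0 : 0 < a := by rw [ha]; exact div_pos (by linarith [hv.2]) hd
  have hb0 : 0 < b := by rw [hb]; exact div_pos (by linarith [hv.1]) hd
  have hab : a + b = 1 := by rw [ha, hb]; field_simp; ring
  have hvab : v = a * v₀ + b * v₁ := by rw [ha, hb]; field_simp; ring
  rw [chord, ← ha, ← hb]
  change _ < min (min (√(π * v)) 1) (√(π * (1 - v)))
  -- Each of the three functions in the minimum is compared separately: the square roots are
  -- strictly concave, and for the constant 1 some endpoint value is below 1.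
  refine lt_min (lt_min ?_ ?_) ?_
  · calc a * torusProfile v₀ + b * torusProfile v₁ ≤ a * √(π * v₀) + b * √(π * v₁) := by
          gcongr <;> exact torusProfile_le_left _
      _ < √(π * v) := by
          rw [hvab]
          exact strict_concave_sqrt_mul h0.le (h0.trans h).le h.ne ha0 hb0 hab
  · have e0 := torusProfile_le_one v₀
    have e1 := torusProfile_le_one v₁
    rcases hp with hp | hp
    · have := torusProfile_lt_one_of_lt hp
      nlinarith
    · have := torusProfile_lt_one_of_gt hp
      nlinarith
  · calc a * torusProfile v₀ + b * torusProfile v₁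
        ≤ a * √(π * (1 - v₀)) + b * √(π * (1 - v₁)) := by
          gcongr <;> exact torusProfile_le_right _
      _ < √(π * (a * (1 - v₀) + b * (1 - v₁))) :=
          strict_concave_sqrt_mul (by linarith) (by linarith) (by intro h; linarith) ha0 hb0 hab
      _ = √(π * (1 - v)) := by
          rw [hvab]; congr 2; linear_combination hab

end Chord

/-! ### The integrand of the time function -/

/-- The integrand of `unduloidTime`. -/
noncomputable def timeDensity (v₀ v₁ w : ℝ) : ℝ :=
  1 / (torusProfile w * √((torusProfile w / chord v₀ v₁ w) ^ 2 - 1))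

theorem timeDensity_nonneg (v₀ v₁ w : ℝ) : 0 ≤ timeDensity v₀ v₁ w := by
  have := torusProfile_nonneg w
  unfold timeDensity; positivity

/-- In this form the difference I² - ℓ² appears under the root and can be factored. -/
theorem timeDensity_eq {v₀ v₁ v : ℝ} (hc : 0 < chord v₀ v₁ v) :
    timeDensity v₀ v₁ v =
      chord v₀ v₁ v / (torusProfile v * √(torusProfile v ^ 2 - chord v₀ v₁ v ^ 2)) := by
  have : (torusProfile v / chord v₀ v₁ v) ^ 2 - 1 =
      (torusProfile v ^ 2 - chord v₀ v₁ v ^ 2) / chord v₀ v₁ v ^ 2 := by field_simp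
  rw [timeDensity, this, Real.sqrt_div' _ (by positivity), Real.sqrt_sq hc.le]
  field_simp

theorem timeDensity_pos {v₀ v₁ v : ℝ} (hc : 0 < chord v₀ v₁ v)
    (h : chord v₀ v₁ v < torusProfile v) : 0 < timeDensity v₀ v₁ v := by
  have : 0 < torusProfile v ^ 2 - chord v₀ v₁ v ^ 2 := by nlinarith
  have := hc.trans h
  rw [timeDensity_eq hc]
  positivity

/-! ### The mean volume of an unduloid that reaches the plateau -/

/-- The integrand of `unduloidTime` in the region where the profile is `√(π v)`: here
`u = √(π v₀)` and `U` are the two solutions `x` of the equation `x = chord (x² / π)`. -/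
theorem timeDensity_eq_sqrt {v₀ v₁ v k u U : ℝ} (hv₀ : 0 ≤ v₀) (h : v₀ < v₁)
    (hk : k = (torusProfile v₁ - torusProfile v₀) / (v₁ - v₀) / π) (hk0 : 0 < k)
    (hu : u = √(π * v₀)) (hU : U = 1 / k - u) (hU1 : 1 ≤ U) (hv : v₀ < v) (hv' : v < 1 / π) :
    timeDensity v₀ v₁ v =
      ((π * v + u * U) / √(U ^ 2 - π * v)) / (√(π * v) * √(π * v - u ^ 2)) := by
  have hpi := Real.pi_pos
  have hz : 0 < π * v := mul_pos hpi (hv₀.trans_lt hv)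
  have hz1 : π * v < 1 := by rwa [lt_div_iff₀' hpi] at hv'
  have hu0 : 0 ≤ u := by rw [hu]; positivity
  have hu2 : u ^ 2 = π * v₀ := by rw [hu, Real.sq_sqrt (by positivity)]
  have huz : 0 < π * v - u ^ 2 := by rw [hu2, ← mul_sub]; exact mul_pos hpi (by linarith)
  have hUz : 0 < U ^ 2 - π * v := by nlinarith
  have hkU : k * (U + u) = 1 := by rw [hU]; field_simp; ring
  have hch : chord v₀ v₁ v = k * (π * v + u * U) := by
    rw [chord_eq h, show (torusProfile v₁ - torusProfile v₀) / (v₁ - v₀) = k * π by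
      rw [hk]; field_simp, torusProfile_of_le (hv.trans hv').le, ← hu]
    linear_combination k * hu2 - u * hkU
  have hch0 : 0 < chord v₀ v₁ v := by rw [hch]; positivity
  -- As a quadratic polynomial in z = πv, I² - ℓ² vanishes exactly at z = u² and z = U².
  have hdiff : √(π * v) ^ 2 - (k * (π * v + u * U)) ^ 2 =
      k ^ 2 * ((U ^ 2 - π * v) * (π * v - u ^ 2)) := by
    rw [Real.sq_sqrt hz.le]
    linear_combination (-(π * v) * (1 + k * (U + u))) * hkU
  rw [timeDensity_eq hch0, torusProfile_of_le hv'.le, hch, hdiff,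
    Real.sqrt_mul (sq_nonneg k), Real.sqrt_sq hk0.le, Real.sqrt_mul hUz.le]
  have := Real.sqrt_pos.2 hz
  have := Real.sqrt_pos.2 hUz
  have := Real.sqrt_pos.2 huz
  field_simp

/-- The right side is the output of `steep_integral_ge` on the whole plateau, scaled by π². It is at
least 0.8 · 0.65 + 2.5 · 0.39 u. -/
theorem steep_bound {u : ℝ} (h0 : 0 ≤ u) (h1 : u ≤ 0.699) :
    0.432 + 0.29 * u ≤ π ^ 2 *
      (0.8 * (((1 - 1 / π) ^ 3 - (1 / π) ^ 3) / 3
        - 4 * π / 81 * ((1 - 1 / π) ^ 2 - (1 / π) ^ 2) / 2)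
      + (u - 0.8 * (u ^ 2 / π)) * (((1 - 1 / π) ^ 2 - (1 / π) ^ 2) / 2
        - 4 * π / 81 * (1 - 1 / π - 1 / π))) := by
  have hpi := Real.pi_gt_d6
  have hpi' := Real.pi_lt_d6
  have e : π ^ 2 *
      (0.8 * (((1 - 1 / π) ^ 3 - (1 / π) ^ 3) / 3
        - 4 * π / 81 * ((1 - 1 / π) ^ 2 - (1 / π) ^ 2) / 2)
      + (u - 0.8 * (u ^ 2 / π)) * (((1 - 1 / π) ^ 2 - (1 / π) ^ 2) / 2
        - 4 * π / 81 * (1 - 1 / π - 1 / π))) =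
      0.8 * ((π - 2) * (π ^ 2 - π + 1) / (3 * π) - 2 * π ^ 2 * (π - 2) / 81) +
      (u * (π - 0.8 * u)) * ((π - 2) * (1 / 2 - 4 * π / 81)) := by
    field_simp
    ring
  rw [e]
  have e2 : 0.65 ≤ (π - 2) * (π ^ 2 - π + 1) / (3 * π) - 2 * π ^ 2 * (π - 2) / 81 := by
    have : 0.93 ≤ (π - 2) * (π ^ 2 - π + 1) / (3 * π) := by
      rw [le_div_iff₀ (by positivity)]
      nlinarith
    have h2 : π ^ 2 ≤ 9.87 := by nlinarith
    have : π ^ 2 * (π - 2) ≤ 9.87 * 1.1416 :=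
      mul_le_mul h2 (by linarith) (by linarith) (by norm_num)
    linarith
  have e3 : 0.39 ≤ (π - 2) * (1 / 2 - 4 * π / 81) := by nlinarith
  have e4 : 2.5 * u ≤ u * (π - 0.8 * u) := by nlinarith
  have : (2.5 * u) * 0.39 ≤ (u * (π - 0.8 * u)) * ((π - 2) * (1 / 2 - 4 * π / 81)) :=
    mul_le_mul e4 e3 (by norm_num) (le_trans (by positivity) e4)
  linarith

/-- The contribution of the volumes at least `1 / π` when the unduloid ends on the plateau. -/
theorem plateau_contribution {v₀ v₁ k u U c : ℝ} (h0 : 0 < v₀) (hv₀ : v₀ < 1 / π)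
    (hk : k = (torusProfile v₁ - torusProfile v₀) / (v₁ - v₀) / π) (hk0 : 0 < k)
    (hu : u = √(π * v₀)) (hkU : k * (U + u) = 1) (hU1 : 1 < U)
    (hv₁ : 1 / π < v₁) (hv₁' : v₁ ≤ 1 - 1 / π)
    (hφ : IntegrableOn (fun v => (v - c) * timeDensity v₀ v₁ v) (Set.Icc (1 / π) v₁)) :
    (1 - π * c) * (√(U ^ 2 - 1) * √(1 - u ^ 2)) ≤
      π ^ 2 * ∫ v in (1 / π)..v₁, (v - c) * timeDensity v₀ v₁ v := by
  have hpi := Real.pi_pos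
  have h : v₀ < v₁ := hv₀.trans hv₁
  have h1 : v₁ < 1 := by linarith [one_div_pos.2 hpi]
  have hd : v₁ - v₀ ≠ 0 := by linarith
  have hk' : (torusProfile v₁ - torusProfile v₀) / (v₁ - v₀) = k * π := by rw [hk]; field_simp
  have hIu : torusProfile v₀ = u := by rw [torusProfile_of_le hv₀.le, hu]
  have hI1 : torusProfile v₁ = 1 := torusProfile_of_mem hv₁.le hv₁'
  have hu0 : 0 < u := by rw [hu]; positivity
  have hu2 : u ^ 2 = π * v₀ := by rw [hu, Real.sq_sqrt (by positivity)]
  have hchord : ∀ v, chord v₀ v₁ v = u + k * π * (v - v₀) := fun v => by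
    rw [chord_eq h, hk', hIu]
  have hend : u + k * π * (v₁ - v₀) = 1 := by
    rw [← hk', hI1, hIu]; field_simp; ring
  -- Both sides are the chord at 1/π, that is, at z = 1.
  have hb : 1 - k * π * (v₁ - 1 / π) = k * (1 + u * U) := by
    have : k * π * (v₁ - 1 / π) = k * π * (v₁ - v₀) - k * (1 - u ^ 2) := by
      rw [hu2]; field_simp; ring
    rw [this]
    linear_combination (-1 : ℝ) * hend - u * hkU
  have plateau := plateau_integral_ge (K := 1 / π - c) (k := k * π) hv₁.le (by positivity)
    hφ (by rw [hb]; positivity) fun v hv => by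
      have e : 1 - k * π * (v₁ - v) = chord v₀ v₁ v := by
        rw [hchord]; linear_combination (-1 : ℝ) * hend
      have hc0 := chord_pos h0 h h1 ⟨hv₀.trans hv.1, hv.2⟩
      rw [e, timeDensity_eq hc0, torusProfile_of_mem hv.1.le (hv.2.le.trans hv₁'), one_mul,
        one_pow]
      gcongr
      exact hv.1.le
  have e1 : 1 - (1 - k * π * (v₁ - 1 / π)) ^ 2 = k ^ 2 * ((U ^ 2 - 1) * (1 - u ^ 2)) := by
    rw [hb]
    linear_combination (-(1 + k * (U + u))) * hkU
  rw [e1, Real.sqrt_mul (sq_nonneg k), Real.sqrt_sq hk0.le,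
    Real.sqrt_mul (by nlinarith)] at plateau
  have e2 : π ^ 2 * ((1 / π - c) / (k * π) * (k * (√(U ^ 2 - 1) * √(1 - u ^ 2)))) =
      (1 - π * c) * (√(U ^ 2 - 1) * √(1 - u ^ 2)) := by
    field_simp
  rw [← e2]
  exact mul_le_mul_of_nonneg_left plateau (by positivity)

/-- The contribution of the volumes at least `1 / π` when the unduloid ends beyond the plateau. -/
theorem steep_contribution {v₀ v₁ u : ℝ} (h0 : 0 < v₀) (hv₀ : v₀ < 1 / π)
    (hslope : 0.8 ≤ (torusProfile v₁ - torusProfile v₀) / (v₁ - v₀))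
    (hu : u = √(π * v₀)) (hu1 : u ≤ 0.699) (h1 : v₁ < 1) (hv₁ : 1 - 1 / π < v₁)
    (hφ : IntegrableOn (fun v => (v - 4 * π / 81) * timeDensity v₀ v₁ v) (Set.Icc (1 / π) v₁)) :
    0.432 + 0.29 * u ≤
      π ^ 2 * ∫ v in (1 / π)..v₁, (v - 4 * π / 81) * timeDensity v₀ v₁ v := by
  have hpi := Real.pi_pos
  have hpi' := Real.pi_lt_d6
  have hp1 := one_div_pi_lt
  have hp2 := lt_one_div_pi
  have hab : 1 / π ≤ 1 - 1 / π := by linarith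
  have h : v₀ < v₁ := by linarith
  have hlt : ∀ v ∈ Set.Ioo v₀ v₁, chord v₀ v₁ v < torusProfile v :=
    fun v hv => chord_lt_torusProfile h0 h h1 (Or.inl hv₀) hv
  have hIu : torusProfile v₀ = u := by rw [torusProfile_of_le hv₀.le, hu]
  have hu0 : 0 < u := by rw [hu]; positivity
  have hv₀u : v₀ = u ^ 2 / π := by rw [hu, Real.sq_sqrt (by positivity)]; field_simp
  have sb := steep_bound hu0.le hu1
  obtain ⟨c, hc⟩ : ∃ c, c = 4 * π / 81 := ⟨_, rfl⟩
  rw [← hc] at hφ sb ⊢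
  have hc1 : c < 0.156 := by rw [hc]; linarith
  have steep := steep_integral_ge (c := c) (g := u - 0.8 * v₀) hab
    (hφ.mono_set (Set.Icc_subset_Icc le_rfl hv₁.le)) fun v hv => by
      refine mul_le_mul_of_nonneg_left ?_ (by linarith [hv.1])
      have hvm : v ∈ Set.Ioo v₀ v₁ := ⟨hv₀.trans hv.1, hv.2.trans hv₁⟩
      have hc0 := chord_pos h0 h h1 hvm
      have hl := hlt v hvm
      have hI := torusProfile_of_mem hv.1.le hv.2.le
      rw [timeDensity_eq hc0, hI, one_mul, one_pow]
      rw [hI] at hl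
      have hs0 : 0 < √(1 - chord v₀ v₁ v ^ 2) := Real.sqrt_pos.2 (by nlinarith)
      have hs1 : √(1 - chord v₀ v₁ v ^ 2) ≤ 1 := by
        rw [Real.sqrt_le_one]; nlinarith
      -- The only place where the value 0.8 of the slope bound matters; elsewhere positivity of the
      -- slope is enough.
      calc 0.8 * v + (u - 0.8 * v₀) ≤ chord v₀ v₁ v := by
            rw [chord_eq h, hIu]
            rw [hIu] at hslope
            linarith [mul_le_mul_of_nonneg_right hslope (sub_nonneg.2 hvm.1.le)]
        _ ≤ _ := le_div_self hc0.le hs0 hs1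
  have hrest : 0 ≤ ∫ v in (1 - 1 / π)..v₁, (v - c) * timeDensity v₀ v₁ v := by
    refine intervalIntegral.integral_nonneg hv₁.le fun v hv => ?_
    exact mul_nonneg (by linarith [hv.1]) (timeDensity_nonneg _ _ _)
  have hφi : ∀ a b, 1 / π ≤ a → a ≤ b → b ≤ v₁ →
      IntervalIntegrable (fun v => (v - c) * timeDensity v₀ v₁ v) volume a b :=
    fun a b ha hab hb => (intervalIntegrable_iff_integrableOn_Icc_of_le hab).2
      (hφ.mono_set (Set.Icc_subset_Icc ha hb))
  have hsum := intervalIntegral.integral_add_adjacent_intervals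
    (hφi (1 / π) (1 - 1 / π) le_rfl hab hv₁.le)
    (hφi (1 - 1 / π) v₁ hab hv₁.le le_rfl)
  rw [← hv₀u] at sb
  refine sb.trans (mul_le_mul_of_nonneg_left ?_ (by positivity))
  rw [← hsum]
  exact steep.trans (le_add_of_nonneg_right hrest)

/-- From 1/π on, the profile no longer increases. -/
theorem lt_one_div_pi_of_slope_pos {v₀ v₁ : ℝ} (h : v₀ < v₁)
    (hslope : 0 < (torusProfile v₁ - torusProfile v₀) / (v₁ - v₀)) : v₀ < 1 / π := by
  by_contra! hcon
  have h2 : torusProfile v₁ ≤ torusProfile v₀ := by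
    rcases le_total v₀ (1 - 1 / π) with h3 | h3
    · rw [torusProfile_of_mem hcon h3]; exact torusProfile_le_one _
    · rw [torusProfile_of_ge h3, torusProfile_of_ge (h3.trans h.le)]
      gcongr
  have : (torusProfile v₁ - torusProfile v₀) / (v₁ - v₀) ≤ 0 :=
    div_nonpos_of_nonpos_of_nonneg (by linarith) (by linarith)
  linarith

/-- The contribution of the volumes in `[v₀, 1 / π]`. -/
theorem sqrt_contribution {v₀ v₁ k u U : ℝ} (h0 : 0 < v₀) (hcv : v₀ < 4 * π / 81)
    (hk : k = (torusProfile v₁ - torusProfile v₀) / (v₁ - v₀) / π) (hk0 : 0 < k)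
    (hu : u = √(π * v₀)) (hU : U = 1 / k - u) (hU1 : 1 < U) (hv₁ : 1 / π < v₁)
    (hφ : IntegrableOn (fun v => (v - 4 * π / 81) * timeDensity v₀ v₁ v) (Set.Icc v₀ (1 / π))) :
    2 / 3 * ((1 + u) / √(1 - u ^ 2)) * ((√(U ^ 2 - 4 * π ^ 2 / 81) - √(U ^ 2 - 1)) ^ 2 *
      (2 * √(U ^ 2 - 4 * π ^ 2 / 81) + √(U ^ 2 - 1))) - (0.432 + 0.29 * u) <
      π ^ 2 * ∫ v in v₀..(1 / π), (v - 4 * π / 81) * timeDensity v₀ v₁ v := by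
  have hpi := Real.pi_pos
  have hpi' := Real.pi_lt_d6
  have hp2 := lt_one_div_pi
  have hm : π * (4 * π / 81) = 4 * π ^ 2 / 81 := by ring
  have hc1 : 4 * π / 81 < 0.156 := by linarith
  obtain ⟨c, hc⟩ : ∃ c, c = 4 * π / 81 := ⟨_, rfl⟩
  rw [← hc] at hφ hcv hc1 hm ⊢
  have hcp : c < 1 / π := by linarith
  have h : v₀ < v₁ := by linarith
  have hu0 : 0 < u := by rw [hu]; positivity
  have hu2 : u ^ 2 = π * v₀ := by rw [hu, Real.sq_sqrt (by positivity)]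
  obtain ⟨hm1, hm2⟩ := four_mul_pi_sq_bounds
  have hm' : 4 * π ^ 2 / 81 = (2 * π / 9) ^ 2 := by ring
  have hum : u ^ 2 < 4 * π ^ 2 / 81 := by
    rw [hu2, ← hm]; exact mul_lt_mul_of_pos_left hcv hpi
  have huc : u < 2 * π / 9 := lt_of_pow_lt_pow_left₀ 2 (by positivity) (by rwa [← hm'])
  have hU2 : 1 < U ^ 2 := by nlinarith
  have hdens : ∀ v, v₀ < v → v < 1 / π → timeDensity v₀ v₁ v =
      ((π * v + u * U) / √(U ^ 2 - π * v)) / (√(π * v) * √(π * v - u ^ 2)) :=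
    fun v hv hv' => timeDensity_eq_sqrt h0.le h hk hk0 hu hU hU1.le hv hv'
  obtain ⟨s, hs⟩ : ∃ s, s = 1 + 0.815 * (u + 0.4874) := ⟨_, rfl⟩
  have hφl := hφ.mono_set (Set.Icc_subset_Icc le_rfl hcp.le)
  have hφr := hφ.mono_set (Set.Icc_subset_Icc hcv.le le_rfl)
  -- Below c the weight v - c is negative, so an upper bound for the time density is needed; above c
  -- a lower bound.
  have left := left_integral_ge (s := s) hu0 hu2.symm hm hcv.le hφl fun v hv => by
      apply mul_le_mul_of_nonpos_left _ (by linarith [hv.2])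
      rw [hdens v hv.1 (hv.2.trans hcp)]
      refine div_le_div_of_nonneg_right ?_ (by positivity)
      refine left_factor_le hu0.le hU1.le (mul_pos hpi (h0.trans hv.1)).le ?_ hm2.le hs
      rw [← hm]
      exact mul_le_mul_of_nonneg_left hv.2.le hpi.le
  rw [leftPrimitive_sub hu0 (by positivity) hm'] at left
  have left_lt := left_total_lt hu0 huc (Real.sqrt_nonneg _)
    (Real.sq_sqrt (by linarith : 0 ≤ 4 * π ^ 2 / 81 - u ^ 2)) hs rfl
  have right := right_integral_ge (N := (1 + u) / √(1 - u ^ 2)) hm (by linarith)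
    hU2 hφr fun v hv => by
      refine mul_le_mul_of_nonneg_left ?_ (by linarith [hv.1])
      rw [hdens v (hcv.trans hv.1) hv.2, div_right_comm (π * v + u * U)]
      refine div_le_div_of_nonneg_right ?_ (by positivity)
      refine le_right_factor hu0 hU1.le ?_ ((lt_div_iff₀' hpi).1 hv.2).le rfl
      rw [hu2]
      exact mul_lt_mul_of_pos_left (hcv.trans hv.1) hpi
  rw [rightPrimitive_sub (by linarith)] at right
  have split := intervalIntegral.integral_add_adjacent_intervals
    ((intervalIntegrable_iff_integrableOn_Icc_of_le hcv.le).2 hφl)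
    ((intervalIntegrable_iff_integrableOn_Icc_of_le hcp.le).2 hφr)
  rw [← split, mul_add (π ^ 2)]
  refine lt_of_le_of_lt (le_of_eq ?_) (add_lt_add_of_lt_of_le (lt_of_lt_of_le (neg_lt_neg left_lt)
    left) right)
  ring

/-- The analytic core: the mean volume of an unduloid reaching past 1/π exceeds 4π/81, since the
gain above that volume outweighs the loss below it. -/
theorem integral_sub_mul_timeDensity_pos {v₀ v₁ : ℝ} (h0 : 0 < v₀) (h : v₀ < v₁) (h1 : v₁ < 1)
    (hslope : 0.8 ≤ (torusProfile v₁ - torusProfile v₀) / (v₁ - v₀)) (hv₁ : 1 / π < v₁)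
    (hint : IntegrableOn (timeDensity v₀ v₁) (Set.Icc v₀ v₁)) :
    0 < ∫ v in v₀..v₁, (v - 4 * π / 81) * timeDensity v₀ v₁ v := by
  have hpi := Real.pi_pos
  have hv₀ : v₀ < 1 / π := lt_one_div_pi_of_slope_pos h (by linarith)
  have hφ : IntegrableOn (fun v => (v - 4 * π / 81) * timeDensity v₀ v₁ v) (Set.Icc v₀ v₁) :=
    hint.continuousOn_mul (by fun_prop) isCompact_Icc
  have hφl := hφ.mono_set (Set.Icc_subset_Icc le_rfl hv₁.le)
  have hφr := hφ.mono_set (Set.Icc_subset_Icc hv₀.le le_rfl)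
  have hlt : ∀ v ∈ Set.Ioo v₀ v₁, chord v₀ v₁ v < torusProfile v :=
    fun v hv => chord_lt_torusProfile h0 h h1 (Or.inl hv₀) hv
  rcases le_or_gt (4 * π / 81) v₀ with hcv | hcv
  · refine intervalIntegral.intervalIntegral_pos_of_pos_on
      ((intervalIntegrable_iff_integrableOn_Icc_of_le h.le).2 hφ) (fun v hv => ?_) h
    exact mul_pos (by linarith [hv.1]) (timeDensity_pos (chord_pos h0 h h1 hv) (hlt v hv))
  obtain ⟨k, hk⟩ : ∃ k, k = (torusProfile v₁ - torusProfile v₀) / (v₁ - v₀) / π := ⟨_, rfl⟩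
  have hk0 : 0 < k := by rw [hk]; apply div_pos _ hpi; linarith
  obtain ⟨u, hu⟩ : ∃ u, u = √(π * v₀) := ⟨_, rfl⟩
  obtain ⟨U, hU⟩ : ∃ U, U = 1 / k - u := ⟨_, rfl⟩
  have hkU : k * (U + u) = 1 := by rw [hU]; field_simp; ring
  have hu0 : 0 < u := by rw [hu]; positivity
  have hu2 : u ^ 2 = π * v₀ := by rw [hu, Real.sq_sqrt (by positivity)]
  obtain ⟨hm1, hm2⟩ := four_mul_pi_sq_bounds
  have hu1 : u ≤ 0.699 := by
    refine le_of_sq_le_sq ?_ (by norm_num)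
    have : π * v₀ < π * (4 * π / 81) := mul_lt_mul_of_pos_left hcv hpi
    rw [hu2]
    norm_num
    linarith
  -- The chord lies below the profile at 1/π, so u + k(1 - u²) < 1; dividing by 1 - u gives k(1 + u)
  -- < 1 = k(U + u).
  have hU1 : 1 < U := by
    have h2 := hlt (1 / π) ⟨hv₀, hv₁⟩
    rw [chord_eq h, show (torusProfile v₁ - torusProfile v₀) / (v₁ - v₀) = k * π by
      rw [hk]; field_simp, torusProfile_of_le hv₀.le, ← hu,
      torusProfile_of_mem le_rfl (by linarith [one_div_pi_lt]),
      show k * π * (1 / π - v₀) = k * (1 - u ^ 2) by rw [hu2]; field_simp] at h2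
    have h3 : k * (1 + u) < 1 :=
      lt_of_mul_lt_mul_left (a := 1 - u) (by linarith) (by linarith)
    have : 0 < k * (U - 1) := by linarith
    have := (pos_iff_pos_of_mul_pos this).1 hk0
    linarith
  have hU2 : 1 < U ^ 2 := by nlinarith
  have hsqrt := sqrt_contribution h0 hcv hk hk0 hu hU hU1 hv₁ hφl
  rw [← intervalIntegral.integral_add_adjacent_intervals
    ((intervalIntegrable_iff_integrableOn_Icc_of_le hv₀.le).2 hφl)
    ((intervalIntegrable_iff_integrableOn_Icc_of_le hv₁.le).2 hφr)]
  refine pos_of_mul_pos_right (a := π ^ 2) ?_ (by positivity)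
  rw [mul_add]
  have hq : √(U ^ 2 - 1) < √(U ^ 2 - 4 * π ^ 2 / 81) :=
    Real.sqrt_lt_sqrt (by linarith) (by linarith)
  -- When v₁ is on the plateau, both positive contributions are needed. Beyond it, the gain on
  -- [4π/81, 1/π] is merely nonnegative and can be discarded.
  rcases le_or_gt v₁ (1 - 1 / π) with hcase | hcase
  · have plateau := plateau_contribution h0 hv₀ hk hk0 hu hkU hU1 hv₁ hcase hφr
    rw [show π * (4 * π / 81) = 4 * π ^ 2 / 81 by ring] at plateau
    have main := le_right_total hu0.le hu1 rfl hq (δ := 1 - 4 * π ^ 2 / 81)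
      (by rw [Real.sq_sqrt (by linarith), Real.sq_sqrt (by linarith)]; ring) (by linarith)
    linarith
  · have steep := steep_contribution h0 hv₀ hslope hu hu1 h1 hcase hφr
    have : 0 ≤ 2 / 3 * ((1 + u) / √(1 - u ^ 2)) *
      ((√(U ^ 2 - 4 * π ^ 2 / 81) - √(U ^ 2 - 1)) ^ 2 *
      (2 * √(U ^ 2 - 4 * π ^ 2 / 81) + √(U ^ 2 - 1))) := by positivity
    linarith

/-! ### The density and its distribution function -/

theorem half_sub_one_div_pi_pos : 0 < 1 / 2 - 1 / π := by linarith [one_div_pi_lt]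

theorem half_sub_lt_torusRadius : 1 / 2 - 1 / π < torusRadius := by
  unfold torusRadius; linarith [one_div_pos.2 Real.pi_pos]

/-- The piecewise formula is a truncated affine function of |s|, which makes continuity immediate.
-/
theorem torusDensity_eq_max (s : ℝ) :
    torusDensity s = max 0 (min 1 (π / 2 * (torusRadius - |s|))) := by
  have hpi := Real.pi_pos
  have h2 : π / 2 * (2 / π) = 1 := by field_simp
  have h3 : 2 / π = 1 / π + 1 / π := by ring
  unfold torusDensity
  split_ifs with h h'
  · rw [min_eq_left, max_eq_right zero_le_one]
    rw [← h2]
    gcongr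
    unfold torusRadius; linarith
  · rw [min_eq_right, max_eq_right]
    · unfold torusRadius; ring
    · exact mul_nonneg (by positivity) (by linarith)
    · rw [← h2]
      gcongr
      unfold torusRadius; linarith
  · rw [min_eq_right, max_eq_left]
    · exact mul_nonpos_of_nonneg_of_nonpos (by positivity) (by linarith)
    · exact (mul_nonpos_of_nonneg_of_nonpos (by positivity) (by linarith)).trans zero_le_one

theorem continuous_torusDensity : Continuous torusDensity := by
  rw [funext torusDensity_eq_max]; fun_prop

theorem torusDensity_nonneg (s : ℝ) : 0 ≤ torusDensity s := by
  rw [torusDensity_eq_max]; exact le_max_left _ _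

theorem torusDensity_pos {s : ℝ} (hs : s ∈ Set.Ioo (-torusRadius) torusRadius) :
    0 < torusDensity s := by
  have : |s| < torusRadius := abs_lt.2 hs
  rw [torusDensity_eq_max]
  exact lt_max_of_lt_right (lt_min one_pos (mul_pos (by positivity) (by linarith)))

theorem torusDensity_eq_zero {s : ℝ} (hs : s ∉ Set.Ioo (-torusRadius) torusRadius) :
    torusDensity s = 0 := by
  have : ¬ |s| < torusRadius := fun h => hs (abs_lt.1 h)
  have h := half_sub_lt_torusRadius
  rw [torusDensity, if_neg (by linarith), if_neg this]

theorem torusDensity_of_left {s : ℝ} (h : -torusRadius ≤ s) (h' : s ≤ -(1 / 2 - 1 / π)) :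
    torusDensity s = π / 2 * (s + torusRadius) := by
  have h0 := half_sub_one_div_pi_pos
  rw [torusDensity_eq_max, abs_of_nonpos (by linarith), min_eq_right, max_eq_right]
  · ring
  · exact mul_nonneg (by positivity) (by linarith)
  · have h2 : π / 2 * (2 / π) = 1 := by field_simp
    rw [← h2]
    gcongr
    unfold torusRadius
    linarith [show 2 / π = 1 / π + 1 / π by ring]

theorem torusDensity_neg (s : ℝ) : torusDensity (-s) = torusDensity s := by
  simp only [torusDensity, abs_neg]

theorem torusDensity_of_right {s : ℝ} (h : 1 / 2 - 1 / π ≤ s) (h' : s ≤ torusRadius) :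
    torusDensity s = π / 2 * (torusRadius - s) := by
  rw [← torusDensity_neg, torusDensity_of_left (by linarith) (by linarith)]
  ring

theorem torusDensity_of_mid {s : ℝ} (h : -(1 / 2 - 1 / π) ≤ s) (h' : s ≤ 1 / 2 - 1 / π) :
    torusDensity s = 1 := if_pos (abs_le.2 ⟨h, h'⟩)

theorem integrable_torusDensity : Integrable torusDensity := by
  refine continuous_torusDensity.integrable_of_hasCompactSupport
    (HasCompactSupport.intro (isCompact_Icc (a := -torusRadius) (b := torusRadius)) fun s hs => ?_)
  exact torusDensity_eq_zero fun h => hs (Set.Ioo_subset_Icc_self h)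

theorem torusCDF_sub (a b : ℝ) : torusCDF b - torusCDF a = ∫ x in a..b, torusDensity x :=
  intervalIntegral.integral_Iic_sub_Iic integrable_torusDensity.integrableOn
    integrable_torusDensity.integrableOn

theorem hasDerivAt_torusCDF (s : ℝ) : HasDerivAt torusCDF (torusDensity s) s := by
  have h : torusCDF = fun b => torusCDF 0 + ∫ x in (0 : ℝ)..b, torusDensity x := by
    ext b; rw [← torusCDF_sub]; ring
  rw [h]
  exact (intervalIntegral.integral_hasDerivAt_right
    (continuous_torusDensity.intervalIntegrable _ _)
    (continuous_torusDensity.stronglyMeasurableAtFilter _ _)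
    continuous_torusDensity.continuousAt).const_add _

theorem continuous_torusCDF : Continuous torusCDF :=
  continuous_iff_continuousAt.2 fun s => (hasDerivAt_torusCDF s).continuousAt

theorem torusCDF_neg_torusRadius : torusCDF (-torusRadius) = 0 := by
  refine setIntegral_eq_zero_of_forall_eq_zero fun x hx => ?_
  exact torusDensity_eq_zero fun h => absurd h.1 (not_lt.2 hx)

/-- Comparison of the distribution function with an antiderivative of the density. -/
theorem torusCDF_sub_eq {F : ℝ → ℝ} {a b : ℝ} (hab : a ≤ b)
    (hF : ∀ x ∈ Set.Icc a b, HasDerivAt F (torusDensity x) x) :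
    torusCDF b - torusCDF a = F b - F a := by
  rw [torusCDF_sub]
  refine intervalIntegral.integral_eq_sub_of_hasDerivAt (fun x hx => hF x ?_)
    (continuous_torusDensity.intervalIntegrable _ _)
  rwa [Set.uIcc_of_le hab] at hx

theorem torusCDF_of_left {s : ℝ} (h : -torusRadius ≤ s) (h' : s ≤ -(1 / 2 - 1 / π)) :
    torusCDF s = π / 4 * (s + torusRadius) ^ 2 := by
  have := torusCDF_sub_eq (F := fun x => π / 4 * (x + torusRadius) ^ 2) h fun x hx => by
    rw [torusDensity_of_left hx.1 (hx.2.trans h')]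
    refine ((((hasDerivAt_id x).add_const torusRadius).pow 2).const_mul (π / 4)).congr_deriv ?_
    simp only [id]; push_cast; ring
  rw [torusCDF_neg_torusRadius] at this
  simpa using this

theorem half_sub_add_torusRadius : -(1 / 2 - 1 / π) + torusRadius = 2 / π := by
  unfold torusRadius; ring

theorem torusCDF_of_mid {s : ℝ} (h : -(1 / 2 - 1 / π) ≤ s) (h' : s ≤ 1 / 2 - 1 / π) :
    torusCDF s = s + 1 / 2 := by
  have := torusCDF_sub_eq (F := fun x => x) h fun x hx => by
    rw [torusDensity_of_mid hx.1 (hx.2.trans h')]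
    exact hasDerivAt_id x
  rw [torusCDF_of_left (by linarith [half_sub_lt_torusRadius]) le_rfl,
    half_sub_add_torusRadius] at this
  have e : π / 4 * (2 / π) ^ 2 = 1 / π := by field_simp; norm_num
  linarith

theorem torusCDF_of_right {s : ℝ} (h : 1 / 2 - 1 / π ≤ s) (h' : s ≤ torusRadius) :
    torusCDF s = 1 - π / 4 * (torusRadius - s) ^ 2 := by
  have h0 := half_sub_one_div_pi_pos
  have := torusCDF_sub_eq (F := fun x => -(π / 4 * (torusRadius - x) ^ 2)) h fun x hx => by
    rw [torusDensity_of_right hx.1 (hx.2.trans h')]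
    refine ((((hasDerivAt_id x).const_sub torusRadius).pow 2).const_mul (π / 4)).neg.congr_deriv ?_
    simp only [id]; push_cast; ring
  rw [torusCDF_of_mid (by linarith) le_rfl, show torusRadius - (1 / 2 - 1 / π) = 2 / π by
    rw [← half_sub_add_torusRadius]; ring] at this
  have e : π / 4 * (2 / π) ^ 2 = 1 / π := by field_simp; norm_num
  linarith

theorem torusCDF_torusRadius : torusCDF torusRadius = 1 := by
  rw [torusCDF_of_right half_sub_lt_torusRadius.le le_rfl]; ring

/-- The density is the isoperimetric profile, as a function of the volume. -/
theorem torusProfile_torusCDF {s : ℝ} (hs : s ∈ Set.Icc (-torusRadius) torusRadius) :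
    torusProfile (torusCDF s) = torusDensity s := by
  have hpi := Real.pi_pos
  have e : π / 4 * (2 / π) ^ 2 = 1 / π := by field_simp; norm_num
  have hR := half_sub_add_torusRadius
  rcases le_total s (-(1 / 2 - 1 / π)) with h1 | h1
  · rw [torusCDF_of_left hs.1 h1, torusDensity_of_left hs.1 h1, torusProfile_of_le]
    · rw [show π * (π / 4 * (s + torusRadius) ^ 2) = (π / 2 * (s + torusRadius)) ^ 2 by ring,
        Real.sqrt_sq (mul_nonneg (by positivity) (by linarith [hs.1]))]
    · rw [← e]
      have : 0 ≤ s + torusRadius := by linarith [hs.1]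
      gcongr
      linarith
  rcases le_total s (1 / 2 - 1 / π) with h2 | h2
  · rw [torusCDF_of_mid h1 h2, torusDensity_of_mid h1 h2, torusProfile_of_mem] <;> linarith
  · rw [torusCDF_of_right h2 hs.2, torusDensity_of_right h2 hs.2, torusProfile_of_ge]
    · rw [show π * (1 - (1 - π / 4 * (torusRadius - s) ^ 2)) = (π / 2 * (torusRadius - s)) ^ 2 by
        ring, Real.sqrt_sq (mul_nonneg (by positivity) (by linarith [hs.2]))]
    · rw [← e]
      have : 0 ≤ torusRadius - s := by linarith [hs.2]
      gcongr
      linarith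

theorem strictMonoOn_torusCDF :
    StrictMonoOn torusCDF (Set.Icc (-torusRadius) torusRadius) := by
  refine strictMonoOn_of_deriv_pos (convex_Icc _ _) continuous_torusCDF.continuousOn fun s hs => ?_
  rw [interior_Icc] at hs
  rw [(hasDerivAt_torusCDF s).deriv]
  exact torusDensity_pos hs

theorem mem_Ioo_of_torusCDF {s : ℝ} (hs : s ∈ Set.Icc (-torusRadius) torusRadius)
    (h : torusCDF s ∈ Set.Ioo 0 1) : s ∈ Set.Ioo (-torusRadius) torusRadius := by
  constructor
  · refine lt_of_le_of_ne hs.1 fun he => ?_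
    rw [← he, torusCDF_neg_torusRadius] at h
    exact lt_irrefl _ h.1
  · refine lt_of_le_of_ne hs.2 fun he => ?_
    rw [he, torusCDF_torusRadius] at h
    exact lt_irrefl _ h.2

/-- The two excluded volumes correspond to the corners ±(1/2 - 1/π); away from them the density is
locally affine. -/
theorem differentiableAt_torusDensity {s : ℝ} (hs : s ∈ Set.Ioo (-torusRadius) torusRadius)
    (h1 : torusCDF s ≠ 1 / π) (h2 : torusCDF s ≠ 1 - 1 / π) :
    DifferentiableAt ℝ torusDensity s := by
  have h0 := half_sub_one_div_pi_pos
  have hs1 : s ≠ -(1 / 2 - 1 / π) := by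
    rintro rfl
    rw [torusCDF_of_mid le_rfl (by linarith)] at h1
    apply h1; ring
  have hs2 : s ≠ 1 / 2 - 1 / π := by
    rintro rfl
    rw [torusCDF_of_mid (by linarith) le_rfl] at h2
    apply h2; ring
  rcases lt_or_gt_of_ne hs1 with h | h
  · refine DifferentiableAt.congr_of_eventuallyEq
      (f := fun s => π / 2 * (s + torusRadius)) (by fun_prop) ?_
    filter_upwards [Ioo_mem_nhds hs.1 h] with x hx
    exact torusDensity_of_left hx.1.le hx.2.le
  rcases lt_or_gt_of_ne hs2 with h' | h'
  · refine DifferentiableAt.congr_of_eventuallyEq (f := fun _ => (1 : ℝ)) (by fun_prop) ?_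
    filter_upwards [Ioo_mem_nhds h h'] with x hx
    exact torusDensity_of_mid hx.1.le hx.2.le
  · refine DifferentiableAt.congr_of_eventuallyEq
      (f := fun s => π / 2 * (torusRadius - s)) (by fun_prop) ?_
    filter_upwards [Ioo_mem_nhds h' hs.2] with x hx
    exact torusDensity_of_right hx.1.le hx.2.le

/-! ### The time function -/

theorem unduloidTime_eq (v₀ v₁ v : ℝ) :
    unduloidTime v₀ v₁ v = ∫ w in v..v₁, timeDensity v₀ v₁ w := rfl

theorem measurable_timeDensity (v₀ v₁ : ℝ) : Measurable (timeDensity v₀ v₁) := by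
  have h1 := continuous_torusProfile.measurable
  have h2 : Measurable (chord v₀ v₁) := by
    unfold chord; fun_prop
  unfold timeDensity
  fun_prop

section Time

variable {v₀ v₁ : ℝ}

theorem continuousAt_timeDensity {v : ℝ} (hc : 0 < chord v₀ v₁ v)
    (h : chord v₀ v₁ v < torusProfile v) : ContinuousAt (timeDensity v₀ v₁) v := by
  have h1 : ContinuousAt torusProfile v := continuous_torusProfile.continuousAt
  have h2 : ContinuousAt (chord v₀ v₁) v := by
    unfold chord; fun_prop
  have h3 : 0 < (torusProfile v / chord v₀ v₁ v) ^ 2 - 1 := by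
    rw [sub_pos]
    exact one_lt_pow₀ ((one_lt_div hc).2 h) two_ne_zero
  have h4 := Real.sqrt_pos.2 h3
  have h5 := hc.trans h
  unfold timeDensity
  exact continuousAt_const.div (h1.mul (((h1.div h2 hc.ne').pow 2).sub continuousAt_const).sqrt)
    (mul_pos h5 h4).ne'

/-- An unduloid is not contained in the plateau. -/
theorem not_plateau_of_halfPeriod_pos (h : v₀ < v₁) (hT : 0 < halfPeriod v₀ v₁) :
    v₀ < 1 / π ∨ 1 - 1 / π < v₁ := by
  by_contra! hcon
  have hz : halfPeriod v₀ v₁ = ∫ w in v₀..v₁, (0 : ℝ) := by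
    refine intervalIntegral.integral_congr fun w hw => ?_
    rw [Set.uIcc_of_le h.le] at hw
    have : chord v₀ v₁ w = 1 := by
      rw [chord_eq h, torusProfile_of_mem hcon.1 (h.le.trans hcon.2),
        torusProfile_of_mem (hcon.1.trans h.le) hcon.2]
      simp
    -- The integrand becomes 1/(1 · √0), which is 0 by the convention for division by zero.
    simp only [this, torusProfile_of_mem (hcon.1.trans hw.1) (hw.2.trans hcon.2)]
    simp
  rw [hz, intervalIntegral.integral_zero] at hT
  exact lt_irrefl _ hT

/-- A non-integrable function has integral 0 by convention, so a positive half-period already forces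
convergence; no endpoint asymptotics are needed. -/
theorem intervalIntegrable_timeDensity (hT : 0 < halfPeriod v₀ v₁) :
    IntervalIntegrable (timeDensity v₀ v₁) volume v₀ v₁ := by
  by_contra hcon
  rw [halfPeriod, unduloidTime_eq, intervalIntegral.integral_undef hcon] at hT
  exact lt_irrefl _ hT

theorem unduloidTime_right : unduloidTime v₀ v₁ v₁ = 0 := intervalIntegral.integral_same

theorem strictAntiOn_unduloidTime (h0 : 0 < v₀) (h : v₀ < v₁) (h1 : v₁ < 1)
    (hT : 0 < halfPeriod v₀ v₁) : StrictAntiOn (unduloidTime v₀ v₁) (Set.Icc v₀ v₁) := by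
  intro a ha b hb hab
  have hint := intervalIntegrable_timeDensity hT
  have sub : ∀ x ∈ Set.Icc v₀ v₁, ∀ y ∈ Set.Icc v₀ v₁,
      IntervalIntegrable (timeDensity v₀ v₁) volume x y := fun x hx y hy =>
    hint.mono_set (by rw [Set.uIcc_of_le h.le]; exact Set.uIcc_subset_Icc hx hy)
  have hsplit := intervalIntegral.integral_add_adjacent_intervals (sub a ha b hb)
    (sub b hb v₁ (Set.right_mem_Icc.2 h.le))
  have hpos : 0 < ∫ w in a..b, timeDensity v₀ v₁ w := by
    refine intervalIntegral.intervalIntegral_pos_of_pos_on (sub a ha b hb) (fun w hw => ?_) hab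
    have hw' : w ∈ Set.Ioo v₀ v₁ := ⟨ha.1.trans_lt hw.1, hw.2.trans_le hb.2⟩
    exact timeDensity_pos (chord_pos h0 h h1 hw')
      (chord_lt_torusProfile h0 h h1 (not_plateau_of_halfPeriod_pos h hT) hw')
  rw [unduloidTime_eq, unduloidTime_eq, ← hsplit]
  linarith

theorem hasDerivAt_unduloidTime (h0 : 0 < v₀) (h : v₀ < v₁) (h1 : v₁ < 1)
    (hT : 0 < halfPeriod v₀ v₁) {v : ℝ} (hv : v ∈ Set.Ioo v₀ v₁) :
    HasDerivAt (unduloidTime v₀ v₁) (-timeDensity v₀ v₁ v) v := by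
  refine intervalIntegral.integral_hasDerivAt_left ?_ ?_ ?_
  · exact (intervalIntegrable_timeDensity hT).mono_set (Set.uIcc_subset_uIcc
      (Set.Icc_subset_uIcc (Set.Ioo_subset_Icc_self hv)) Set.right_mem_uIcc)
  · exact (measurable_timeDensity v₀ v₁).stronglyMeasurable.stronglyMeasurableAtFilter
  · exact continuousAt_timeDensity (chord_pos h0 h h1 hv)
      (chord_lt_torusProfile h0 h h1 (not_plateau_of_halfPeriod_pos h hT) hv)

end Time

/-! ### Generalized unduloids -/

namespace IsGeneralizedUnduloid

variable {β v₀ v₁ : ℝ} {f : ℝ → ℝ}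

theorem halfPeriod_pos (hf : IsGeneralizedUnduloid β v₀ v₁ f) (hβ : 0 < β) :
    0 < halfPeriod v₀ v₁ := hf.halfPeriod_eq.symm ▸ hβ

theorem strictAntiOn (hf : IsGeneralizedUnduloid β v₀ v₁ f) (hβ : 0 < β) :
    StrictAntiOn (unduloidTime v₀ v₁) (Set.Icc v₀ v₁) :=
  strictAntiOn_unduloidTime hf.pos hf.lt hf.lt_one (hf.halfPeriod_pos hβ)

theorem chord_pos (hf : IsGeneralizedUnduloid β v₀ v₁ f) {v : ℝ} (hv : v ∈ Set.Ioo v₀ v₁) :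
    0 < chord v₀ v₁ v := ModelSlab.chord_pos hf.pos hf.lt hf.lt_one hv

theorem chord_lt (hf : IsGeneralizedUnduloid β v₀ v₁ f) (hβ : 0 < β) {v : ℝ}
    (hv : v ∈ Set.Ioo v₀ v₁) : chord v₀ v₁ v < torusProfile v :=
  chord_lt_torusProfile hf.pos hf.lt hf.lt_one
    (not_plateau_of_halfPeriod_pos hf.lt (hf.halfPeriod_pos hβ)) hv

theorem unduloidTime_mem (hf : IsGeneralizedUnduloid β v₀ v₁ f) (hβ : 0 < β) {v : ℝ}
    (hv : v ∈ Set.Ioo v₀ v₁) : unduloidTime v₀ v₁ v ∈ Set.Ioo 0 β := by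
  have ha := hf.strictAntiOn hβ
  have hv' := Set.Ioo_subset_Icc_self hv
  constructor
  · rw [← unduloidTime_right (v₀ := v₀) (v₁ := v₁)]
    exact ha hv' (Set.right_mem_Icc.2 hf.lt.le) hv.2
  · have := ha (Set.left_mem_Icc.2 hf.lt.le) hv' hv.1
    rwa [← halfPeriod, hf.halfPeriod_eq] at this

theorem torusCDF_unduloidTime (hf : IsGeneralizedUnduloid β v₀ v₁ f) (hβ : 0 < β) {v : ℝ}
    (hv : v ∈ Set.Ioo v₀ v₁) : torusCDF (f (unduloidTime v₀ v₁ v)) = v := by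
  have ht := Set.Ioo_subset_Icc_self (hf.unduloidTime_mem hβ hv)
  exact (hf.strictAntiOn hβ).injOn (hf.cdf_mem _ ht) (Set.Ioo_subset_Icc_self hv)
    (hf.time_eq _ ht)

theorem torusCDF_mem_Ioo (hf : IsGeneralizedUnduloid β v₀ v₁ f) {t : ℝ} (ht : t ∈ Set.Ioo 0 β) :
    torusCDF (f t) ∈ Set.Ioo v₀ v₁ := by
  have ht' := Set.Ioo_subset_Icc_self ht
  have hmem := hf.cdf_mem t ht'
  have htime := hf.time_eq t ht'
  constructor
  · refine lt_of_le_of_ne hmem.1 fun he => ?_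
    rw [← he, ← halfPeriod, hf.halfPeriod_eq] at htime
    exact ht.2.ne htime.symm
  · refine lt_of_le_of_ne hmem.2 fun he => ?_
    rw [he, unduloidTime_right] at htime
    exact ht.1.ne htime

theorem mem_Ioo (hf : IsGeneralizedUnduloid β v₀ v₁ f) {t : ℝ} (ht : t ∈ Set.Ioo 0 β) :
    f t ∈ Set.Ioo (-torusRadius) torusRadius := by
  have h := hf.torusCDF_mem_Ioo ht
  exact mem_Ioo_of_torusCDF (hf.mapsTo t (Set.Ioo_subset_Icc_self ht))
    ⟨hf.pos.trans h.1, h.2.trans hf.lt_one⟩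

/-- The differential equation of first order satisfied by a generalized unduloid. -/
theorem hasDerivAt (hf : IsGeneralizedUnduloid β v₀ v₁ f) (hβ : 0 < β) {t : ℝ}
    (ht : t ∈ Set.Ioo 0 β) :
    HasDerivAt f (-√((torusDensity (f t) / chord v₀ v₁ (torusCDF (f t))) ^ 2 - 1)) t := by
  have hv := hf.torusCDF_mem_Ioo ht
  have hs := hf.mem_Ioo ht
  have ht' := hf.time_eq t (Set.Ioo_subset_Icc_self ht)
  have hev : ∀ᶠ x in nhds (f t), x ∈ Set.Ioo (-torusRadius) torusRadius ∧
      torusCDF x ∈ Set.Ioo v₀ v₁ :=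
    (show ∀ᶠ x in nhds (f t), x ∈ Set.Ioo _ _ from Ioo_mem_nhds hs.1 hs.2).and
      (continuous_torusCDF.continuousAt.eventually (Ioo_mem_nhds hv.1 hv.2))
  have hw := timeDensity_pos (hf.chord_pos hv) (hf.chord_lt hβ hv)
  have hφ := torusDensity_pos hs
  have hT : HasStrictDerivAt (fun x => unduloidTime v₀ v₁ (torusCDF x))
      (-timeDensity v₀ v₁ (torusCDF (f t)) * torusDensity (f t)) (f t) := by
    refine hasStrictDerivAt_of_hasDerivAt_of_continuousAt
      (f' := fun x => -timeDensity v₀ v₁ (torusCDF x) * torusDensity x) ?_ ?_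
    · filter_upwards [hev] with x hx
      exact (hasDerivAt_unduloidTime hf.pos hf.lt hf.lt_one (hf.halfPeriod_pos hβ) hx.2).comp x
        (hasDerivAt_torusCDF x)
    · exact ((continuousAt_timeDensity (hf.chord_pos hv) (hf.chord_lt hβ hv)).comp
        (f := torusCDF) continuous_torusCDF.continuousAt).neg.mul
        continuous_torusDensity.continuousAt
  have hinv : ∀ᶠ x in nhds (f t), f (unduloidTime v₀ v₁ (torusCDF x)) = x := by
    filter_upwards [hev] with x hx
    have hmem := hf.unduloidTime_mem hβ hx.2
    exact strictMonoOn_torusCDF.injOn (Set.Ioo_subset_Icc_self (hf.mem_Ioo hmem))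
      (Set.Ioo_subset_Icc_self hx.1) (hf.torusCDF_unduloidTime hβ hx.2)
  -- Near f(t), f is a left inverse of the strictly differentiable map τ ∘ Φ. Differentiability of f
  -- follows without assuming that f is continuous.
  have hd := (hT.to_local_left_inverse (by
    exact (mul_neg_of_neg_of_pos (neg_neg_of_pos hw) hφ).ne) hinv).hasDerivAt
  simp only [ht'] at hd
  refine hd.congr_deriv ?_
  rw [timeDensity, torusProfile_torusCDF (Set.Ioo_subset_Icc_self hs)]
  field_simp

/-- The weighted mean curvature of a generalized unduloid is the slope of the chord. -/
theorem weightedMeanCurvature_eq (hf : IsGeneralizedUnduloid β v₀ v₁ f) (hβ : 0 < β) {t : ℝ}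
    (ht : t ∈ Set.Ioo 0 β) (hφ : DifferentiableAt ℝ torusDensity (f t)) :
    weightedMeanCurvature f t = (torusProfile v₁ - torusProfile v₀) / (v₁ - v₀) := by
  have hv := hf.torusCDF_mem_Ioo ht
  have hs := hf.mem_Ioo ht
  have hp := torusDensity_pos hs
  have hc := hf.chord_pos hv
  have hlt := hf.chord_lt hβ hv
  rw [torusProfile_torusCDF (Set.Ioo_subset_Icc_self hs)] at hlt
  obtain ⟨k, hk⟩ : ∃ k, k = (torusProfile v₁ - torusProfile v₀) / (v₁ - v₀) := ⟨_, rfl⟩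
  have hchord : HasDerivAt (chord v₀ v₁) k (torusCDF (f t)) := by
    rw [funext (chord_eq hf.lt), ← hk]
    simpa using (((hasDerivAt_id (torusCDF (f t))).sub_const v₀).const_mul k).const_add
      (torusProfile v₀)
  have hh := hφ.hasDerivAt.div (hchord.comp (f t) (hasDerivAt_torusCDF (f t))) hc.ne'
  have hone : 1 < torusDensity (f t) / chord v₀ v₁ (torusCDF (f t)) := (one_lt_div hc).2 hlt
  have hpos : 0 < (torusDensity (f t) / chord v₀ v₁ (torusCDF (f t))) ^ 2 - 1 := by nlinarith
  have hd := hf.hasDerivAt hβ ht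
  have hev : deriv f =ᶠ[nhds t]
      fun x => -√((torusDensity (f x) / chord v₀ v₁ (torusCDF (f x))) ^ 2 - 1) := by
    filter_upwards [Ioo_mem_nhds ht.1 ht.2] with x hx
    exact (hf.hasDerivAt hβ hx).deriv
  have hdd := (((hh.comp t hd).pow 2).sub_const 1).sqrt (by exact hpos.ne') |>.neg
  have hdd' := (hdd.congr_of_eventuallyEq hev).deriv
  have hlog := (hφ.hasDerivAt.log hp.ne').deriv
  rw [weightedMeanCurvature, hdd', hlog, hd.deriv, ← hk]
  simp only [Function.comp_apply, Pi.div_apply, Pi.pow_apply]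
  -- With h = φ/ℓ(Φ) as a function of s, √(1 + f'²) = h(f) and f'' = (h h')(f). The curvature is
  -- therefore (1/h)' + (log φ)'/h = (ℓ ∘ Φ)'/φ, the slope of ℓ.
  have hsq : √(1 + (-√((torusDensity (f t) / chord v₀ v₁ (torusCDF (f t))) ^ 2 - 1)) ^ 2) =
      torusDensity (f t) / chord v₀ v₁ (torusCDF (f t)) := by
    rw [neg_sq, Real.sq_sqrt hpos.le, add_sub_cancel, Real.sqrt_sq (by positivity)]
  rw [hsq]
  have hsp := Real.sqrt_pos.2 hpos
  generalize √((torusDensity (f t) / chord v₀ v₁ (torusCDF (f t))) ^ 2 - 1) = r at *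
  generalize chord v₀ v₁ (torusCDF (f t)) = c at *
  generalize deriv torusDensity (f t) = d
  generalize torusDensity (f t) = p at *
  rw [show 2 - 1 = 1 from rfl, pow_one, Nat.cast_ofNat]
  field_simp
  ring

/-- The constant value of the weighted mean curvature is the slope of the chord. -/
theorem eq_slope (hf : IsGeneralizedUnduloid β v₀ v₁ f) (hβ : 0 < β) {l : ℝ}
    (hl : HasWeightedMeanCurvature β f l) :
    l = (torusProfile v₁ - torusProfile v₀) / (v₁ - v₀) := by
  -- The curvature hypothesis says nothing at corners of the density, so one volume away from them
  -- is chosen.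
  obtain ⟨v, hv, hv'⟩ : ∃ v ∈ Set.Ioo v₀ v₁, v ∉ ({1 / π, 1 - 1 / π} : Set ℝ) :=
    ((Set.Ioo_infinite hf.lt).sdiff (Set.toFinite _)).nonempty
  simp only [Set.mem_insert_iff, Set.mem_singleton_iff, not_or] at hv'
  have ht := hf.unduloidTime_mem hβ hv
  have hcdf := hf.torusCDF_unduloidTime hβ hv
  have hφ : DifferentiableAt ℝ torusDensity (f (unduloidTime v₀ v₁ v)) :=
    differentiableAt_torusDensity (hf.mem_Ioo ht) (by rw [hcdf]; exact hv'.1)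
      (by rw [hcdf]; exact hv'.2)
  rw [← hl _ ht hφ, hf.weightedMeanCurvature_eq hβ ht hφ]

end IsGeneralizedUnduloid

/-! ### The enclosed volume -/

/-- Passing to a measurable hull gives this half of Tonelli for arbitrary sets, so the subgraph need
not be shown measurable. -/
theorem lintegral_measure_section_le_prod {α γ : Type*} [MeasurableSpace α] [MeasurableSpace γ]
    (μ : Measure α) (ν : Measure γ) [SFinite ν] (s : Set (α × γ)) :
    ∫⁻ x, ν (Prod.mk x ⁻¹' s) ∂μ ≤ μ.prod ν s := by
  rw [← measure_toMeasurable s, Measure.prod_apply (measurableSet_toMeasurable _ _)]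
  exact lintegral_mono fun x => measure_mono (Set.preimage_mono (subset_toMeasurable _ _))

theorem ofReal_torusCDF (x : ℝ) : ENNReal.ofReal (torusCDF x) =
    ((volume.restrict (Set.Ioo (-torusRadius) torusRadius)).withDensity
      fun s => ENNReal.ofReal (torusDensity s))
      {s | s ∈ Set.Ioo (-torusRadius) torusRadius ∧ s ≤ x} := by
  have hset : {s | s ∈ Set.Ioo (-torusRadius) torusRadius ∧ s ≤ x} =
      Set.Iic x ∩ Set.Ioo (-torusRadius) torusRadius := by
    ext s; simp [and_comm]
  have hm : MeasurableSet {s | s ∈ Set.Ioo (-torusRadius) torusRadius ∧ s ≤ x} := by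
    rw [hset]; measurability
  rw [withDensity_apply _ hm, Measure.restrict_restrict hm, hset, Set.inter_assoc, Set.inter_self,
    torusCDF, ofReal_integral_eq_lintegral_ofReal integrable_torusDensity.integrableOn
      (Filter.Eventually.of_forall torusDensity_nonneg), Set.inter_comm,
    ← Measure.restrict_restrict measurableSet_Ioo, ← lintegral_indicator measurableSet_Ioo]
  congr 1
  ext s
  by_cases hs : s ∈ Set.Ioo (-torusRadius) torusRadius
  · rw [Set.indicator_of_mem hs]
  · rw [Set.indicator_of_notMem hs, torusDensity_eq_zero hs, ENNReal.ofReal_zero]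

theorem lintegral_torusCDF_le_slabMeasure (β : ℝ) (f : ℝ → ℝ) :
    ENNReal.ofReal (1 / β) * ∫⁻ t in Set.Icc 0 β, ENNReal.ofReal (torusCDF (f t)) ≤
      slabMeasure β (subgraph β f) := by
  refine le_trans (le_of_eq ?_) (lintegral_measure_section_le_prod _ _ _)
  rw [lintegral_smul_measure, smul_eq_mul]
  congr 1
  refine setLIntegral_congr_fun measurableSet_Icc fun t ht => ?_
  rw [ofReal_torusCDF]
  congr 1
  ext s
  simp only [subgraph, Set.mem_preimage, Set.mem_ofPred_eq]
  exact ⟨fun h => ⟨ht, h⟩, fun h => h.2⟩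

/-- Substituting t = τ(v) in the volume of the subgraph gives the mean of v against the time
density, whose total mass is β. -/
theorem IsGeneralizedUnduloid.integral_le {β v₀ v₁ c : ℝ} {f : ℝ → ℝ}
    (hf : IsGeneralizedUnduloid β v₀ v₁ f) (hβ : 0 < β) (hc : 0 ≤ c)
    (hvol : slabMeasure β (subgraph β f) ≤ ENNReal.ofReal c) :
    ∫ v in v₀..v₁, (v - c) * timeDensity v₀ v₁ v ≤ 0 := by
  have hint := intervalIntegrable_timeDensity (hf.halfPeriod_pos hβ)
  have hintv : IntervalIntegrable (fun v => v * timeDensity v₀ v₁ v) volume v₀ v₁ :=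
    hint.continuousOn_mul continuousOn_id
  have hchange : ∫⁻ v in Set.Ioo v₀ v₁, ENNReal.ofReal (v * timeDensity v₀ v₁ v) ≤
      ∫⁻ t in Set.Icc 0 β, ENNReal.ofReal (torusCDF (f t)) := by
    calc ∫⁻ v in Set.Ioo v₀ v₁, ENNReal.ofReal (v * timeDensity v₀ v₁ v)
        = ∫⁻ v in Set.Ioo v₀ v₁, ENNReal.ofReal |-timeDensity v₀ v₁ v| *
            ENNReal.ofReal (torusCDF (f (unduloidTime v₀ v₁ v))) := by
          refine setLIntegral_congr_fun measurableSet_Ioo fun v hv => ?_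
          rw [hf.torusCDF_unduloidTime hβ hv, abs_neg, abs_of_nonneg (timeDensity_nonneg _ _ _),
            ← ENNReal.ofReal_mul (timeDensity_nonneg _ _ _), mul_comm]
      _ = ∫⁻ t in unduloidTime v₀ v₁ '' Set.Ioo v₀ v₁, ENNReal.ofReal (torusCDF (f t)) := by
          refine (lintegral_image_eq_lintegral_abs_deriv_mul measurableSet_Ioo (fun v hv =>
            (hasDerivAt_unduloidTime hf.pos hf.lt hf.lt_one (hf.halfPeriod_pos hβ)
              hv).hasDerivWithinAt) ?_ fun t => ENNReal.ofReal (torusCDF (f t))).symm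
          exact (hf.strictAntiOn hβ).injOn.mono Set.Ioo_subset_Icc_self
      -- Only the inclusion of the image of τ in [0, β] is needed, since an upper bound for the
      -- integral in v suffices.
      _ ≤ _ := by
          refine lintegral_mono_set ?_
          rintro _ ⟨v, hv, rfl⟩
          exact Set.Ioo_subset_Icc_self (hf.unduloidTime_mem hβ hv)
  have heq : ENNReal.ofReal (∫ v in v₀..v₁, v * timeDensity v₀ v₁ v) =
      ∫⁻ v in Set.Ioo v₀ v₁, ENNReal.ofReal (v * timeDensity v₀ v₁ v) := by
    rw [intervalIntegral.integral_of_le hf.lt.le, integral_Ioc_eq_integral_Ioo]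
    refine ofReal_integral_eq_lintegral_ofReal ?_ ?_
    · exact ((intervalIntegrable_iff_integrableOn_Ioo_of_le hf.lt.le).1 hintv)
    · filter_upwards [ae_restrict_mem measurableSet_Ioo] with v hv
      exact mul_nonneg (hf.pos.trans hv.1).le (timeDensity_nonneg _ _ _)
  have hle : ENNReal.ofReal (1 / β * ∫ v in v₀..v₁, v * timeDensity v₀ v₁ v) ≤
      ENNReal.ofReal c := by
    rw [ENNReal.ofReal_mul (by positivity), heq]
    exact (mul_le_mul_right hchange _).trans ((lintegral_torusCDF_le_slabMeasure β f).trans hvol)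
  rw [ENNReal.ofReal_le_ofReal_iff hc, one_div_mul_eq_div, div_le_iff₀ hβ] at hle
  have hβe : ∫ v in v₀..v₁, timeDensity v₀ v₁ v = β := hf.halfPeriod_eq
  simp only [sub_mul]
  rw [intervalIntegral.integral_sub hintv (hint.const_mul c),
    intervalIntegral.integral_const_mul, hβe]
  linarith

end ModelSlab

theorem proposition4p1 (β v₀ v₁ l : ℝ) (f : ℝ → ℝ) (hβ : 0 < β)
    (hf : ModelSlab.IsGeneralizedUnduloid β v₀ v₁ f)
    (hl : ModelSlab.HasWeightedMeanCurvature β f l) (hl_ge : 0.8 ≤ l)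
    (hvol : ModelSlab.slabMeasure β (ModelSlab.subgraph β f) ≤ ENNReal.ofReal (4 * π / 81)) :
    v₁ ≤ 1 / π := by
  by_contra! hv₁
  have hslope := hf.eq_slope hβ hl
  have hint := ModelSlab.intervalIntegrable_timeDensity (hf.halfPeriod_pos hβ)
  have hpos := ModelSlab.integral_sub_mul_timeDensity_pos hf.pos hf.lt hf.lt_one
    (hslope ▸ hl_ge) hv₁ ((intervalIntegrable_iff_integrableOn_Icc_of_le hf.lt.le).1 hint)
  exact absurd (hf.integral_le hβ (by positivity) hvol) (not_le.2 hpos)
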